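/- **Notation.** Let $\lambda$ be a partition with conjugate $\lambda'$, let $|\lambda|$ be its size and let $d(\lambda)$ be the size of its Durfee square (the number of cells on the main diagonal of its Young diagram). The Frobenius notation of $\lambda$ is $(a_1,\dots,a_d\mid b_1,\dots,b_d)$ with $d=d(\lambda)$, $a_i=\lambda_i-i$ and $b_i=\lambda_i'-i$. For an integer $k$, $\lambda$ is called *$k$-asymmetric* if $b_i=a_i+k$ for all $1\le i\le d$. We write $s_\lambda(x_1,\dots,x_N)$ for the Schur polynomial, i.e. the generating function of the semistandard Young tableaux of shape $\lambda$ with entries in $\{1,\dots,N\}$. Let $\mathrm{TSPP}_m$ be the (finite) set of totally symmetric plane partitions inside an $(m,m,m)$-box: arrays $T=(T_{i,j})_{1\le i,j\le m}$ with entries in $\{0,\dots,m\}$ and weakly decreasing rows and columns such that the set $\{(i,j,l): 1\le l\le T_{i,j}\}$ is invariant under all permutations of the three coordinates. For $T\in\mathrm{TSPP}_m$ let $(a_1,\dots,a_d\mid b_1,\dots,b_d)$ be the Frobenius notation of the conjugate of the partition $(T_{1,1},\dots,T_{m,m})$; one always has $a_i\le b_i$. Put $$\omega(T)=r^{d}\,u^{\sum_i(a_i+1)}\,v^{\binom{m+1}{2}-\sum_i(b_i+1)}\,w^{\sum_i(b_i-a_i)}$$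 and, for $k\ge -1$, let $\pi_k(T)$ be the partition with Frobenius notation $(a_1,\dots,a_d\mid b_1+k,\dots,b_d+k)$; if $k=-1$ and $b_d=0$ (so that also $a_d=0$), the last hook $(0\mid -1)$, which has no cells, is omitted. For integers $n\ge1$ and $k\ge-1$ define $$\mathcal A_{n,k}(x_1,\dots,x_N;r,u,v,w)=\sum_{T\in\mathrm{TSPP}_{n-1}}\omega(T)\,s_{\pi_k(T)}(x_1,\dots,x_N).$$ **Statement.** For every $n\ge1$ the following identities hold in $\mathbb Q[x_1,\dots,x_n]$ (with $w^0=1$ at $w=0$), where in each of the three sums over $\lambda$ only finitely many of the polynomials $s_\lambda(x_1,\dots,x_n)$ are nonzero: $$\mathcal A_{n,1}(x_1,\dots,x_n;1,1,1,0)=\sum_{\lambda\ 1\text{-asymmetric}} s_\lambda(x_1,\dots,x_n)=\prod_{1\le i<j\le n}(1+x_ix_j),$$ $$\mathcal A_{n+1,0}(x_1,\dots,x_n;1,-1,1,0)=\sum_{\lambda\ 0\text{-asymmetric}}(-1)^{(|\lambda|+d(\lambda))/2}s_\lambda(x_1,\dots,x_n)=\prod_{i=1}^n(1-x_i)\prod_{1\le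 i<j\le n}(1-x_ix_j),$$ $$\tfrac12\,\mathcal A_{n+2,-1}(x_1,\dots,x_n;1,1,1,0)=\sum_{\lambda\ (-1)\text{-asymmetric}} s_\lambda(x_1,\dots,x_n)=\prod_{i=1}^n(1+x_i^2)\prod_{1\le i<j\le n}(1+x_ix_j).$$ -/

import Mathlib

open scoped BigOperators

/-! ### Semistandard tableaux with bounded entries and Schur polynomials -/

/-- Semistandard Young tableaux of shape `μ` with entries in the alphabet `{0, …, N - 1}`
(standing for `{1, …, N}`). -/
def BoundedSSYT (μ : YoungDiagram) (N : ℕ) : Type :=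
  {T : SemistandardYoungTableau μ // ∀ c ∈ μ.cells, T c.1 c.2 < N}

namespace BoundedSSYT

/-- The entry of `T` in the cell `c`, as an index of one of the `N` variables. -/
def entry {μ : YoungDiagram} {N : ℕ} (T : BoundedSSYT μ N) (c : {c // c ∈ μ.cells}) : Fin N :=
  ⟨T.1 c.1.1 c.1.2, T.2 c.1 c.2⟩

theorem entry_injective (μ : YoungDiagram) (N : ℕ) :
    Function.Injective (fun T : BoundedSSYT μ N => T.entry) := by
  intro T T' h
  apply Subtype.ext
  apply SemistandardYoungTableau.ext
  intro i j
  by_cases hc : (i, j) ∈ μ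
  · have := congrFun h ⟨(i, j), (YoungDiagram.mem_cells _).2 hc⟩
    exact congrArg Fin.val this
  · rw [T.1.zeros hc, T'.1.zeros hc]

instance (μ : YoungDiagram) (N : ℕ) : Finite (BoundedSSYT μ N) :=
  Finite.of_injective _ (entry_injective μ N)

noncomputable instance (μ : YoungDiagram) (N : ℕ) : Fintype (BoundedSSYT μ N) :=
  Fintype.ofFinite _

end BoundedSSYT

/-- The Schur polynomial `s_μ(x_1, …, x_N)`: the generating function of semistandard Young
tableaux of shape `μ` with entries at most `N`. -/
noncomputable def schurPoly (R : Type*) [CommRing R] (N : ℕ) (μ : YoungDiagram) :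
    MvPolynomial (Fin N) R :=
  ∑ T : BoundedSSYT μ N, ∏ c : {c // c ∈ μ.cells}, MvPolynomial.X (T.entry c)

/-! ### Frobenius notation

Rows and columns are indexed from `0`. The Frobenius notation of `μ` is
`(arm 0, …, arm (d-1) | leg 0, …, leg (d-1))` with `d = durfee μ`. -/

namespace YoungDiagram

/-- Size of the Durfee square: the number of cells on the main diagonal. -/
def durfee (μ : YoungDiagram) : ℕ := (μ.cells.filter (fun c => c.1 = c.2)).card

/-- `λ_{i+1} - (i+1)`; only used for `i < durfee μ`, where the subtraction does not truncate. -/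
def arm (μ : YoungDiagram) (i : ℕ) : ℕ := μ.rowLen i - (i + 1)

/-- `λ'_{i+1} - (i+1)`; only used for `i < durfee μ`, where the subtraction does not truncate. -/
def leg (μ : YoungDiagram) (i : ℕ) : ℕ := μ.colLen i - (i + 1)

/-- `μ` is `k`-asymmetric: its Frobenius notation is `(a_1, …, a_d | a_1 + k, …, a_d + k)`
(for negative `k` the same as `(b_1 - k, …, b_d - k | b_1, …, b_d)`). -/
def IsAsymmetric (k : ℤ) (μ : YoungDiagram) : Prop :=
  ∀ i, i < μ.durfee → (μ.leg i : ℤ) = (μ.arm i : ℤ) + k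

/-- The partition with Frobenius notation `(a_1, …, a_d | b_1 + k, …, b_d + k)`, where
`(a_1, …, a_d | b_1, …, b_d)` is the Frobenius notation of `μ`, for `k ≥ -1` and `μ` satisfying
`a_i ≤ b_i`. A cell `(i, j)` weakly above the diagonal lies in the arm of the diagonal cell
`(i, i)` when `j - i ≤ a`, and a cell weakly below lies in the leg of `(j, j)` when `i - j ≤ b + k`;
a diagonal cell has to satisfy both. When `k = -1` and `a_d = b_d = 0`, the last hook `(0 | -1)`
has `0 + (-1) + 1 = 0` cells and is thereby omitted. -/
def frobeniusShift (μ : YoungDiagram) (k : ℤ) (hk : -1 ≤ k)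
    (hμ : ∀ i, (i, i) ∈ μ → μ.arm i ≤ μ.leg i) : YoungDiagram where
  cells := (Finset.range (μ.rowLen 0 + μ.colLen 0 + k.toNat) ×ˢ
      Finset.range (μ.rowLen 0 + μ.colLen 0 + k.toNat)).filter (fun c =>
    (min c.1 c.2, min c.1 c.2) ∈ μ ∧
    (c.1 ≤ c.2 → c.2 ≤ c.1 + μ.arm c.1) ∧
    (c.2 ≤ c.1 → (c.1 : ℤ) ≤ c.2 + (μ.leg c.2 + k)))
  isLowerSet := by
    rintro ⟨i, j⟩ ⟨i', j'⟩ hle hmem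
    obtain ⟨hi, hj⟩ : i' ≤ i ∧ j' ≤ j := hle
    simp only [Finset.coe_filter, Finset.mem_product, Finset.mem_range, Set.mem_ofPred_eq] at hmem ⊢
    obtain ⟨⟨hbi, hbj⟩, hd, hA, hL⟩ := hmem
    have hd' : (min i' j', min i' j') ∈ μ :=
      μ.up_left_mem (min_le_min hi hj) (min_le_min hi hj) hd
    refine ⟨⟨by omega, by omega⟩, hd', ?_, ?_⟩
    · intro h
      rw [min_eq_left h] at hd'
      have hr' := YoungDiagram.mem_iff_lt_rowLen.1 hd'
      rcases le_total i j with hij | hij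
      · rw [min_eq_left hij] at hd
        have hr := YoungDiagram.mem_iff_lt_rowLen.1 hd
        have h1 := hA hij
        have h2 := μ.rowLen_anti _ _ hi
        simp only [arm] at h1 ⊢
        omega
      · rw [min_eq_right hij] at hd
        have hr := YoungDiagram.mem_iff_lt_rowLen.1 hd
        have h2 := μ.rowLen_anti i' j (by omega)
        simp only [arm]
        omega
    · intro h
      rw [min_eq_right h] at hd'
      have hc' := YoungDiagram.mem_iff_lt_colLen.1 hd'
      rcases le_total j i with hij | hij
      · rw [min_eq_right hij] at hd
        have hc := YoungDiagram.mem_iff_lt_colLen.1 hd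
        have h1 := hL hij
        have h2 := μ.colLen_anti _ _ hj
        simp only [leg] at h1 ⊢
        omega
      · rw [min_eq_left hij] at hd
        have hc := YoungDiagram.mem_iff_lt_colLen.1 hd
        have hr := YoungDiagram.mem_iff_lt_rowLen.1 hd
        have h2 := μ.colLen_anti j' i (by omega)
        have h3 := hμ i hd
        have h4 := hA hij
        have h5 : j ≤ i → (i : ℤ) ≤ j + (μ.leg j + k) := hL
        rcases Nat.lt_or_ge i j with hlt | hge
        · simp only [arm, leg] at h3 h4 ⊢
          omega
        · have hE : i = j := by omega
          subst hE
          have h6 := h5 le_rfl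
          simp only [leg] at h6 ⊢
          omega

end YoungDiagram

/-! ### Totally symmetric plane partitions -/

/-- `T` (an array with entries in `[0, m]`) is a totally symmetric plane partition inside the
`(m, m, m)`-box: rows and columns weakly decrease, the array is symmetric, and the corresponding
stack of unit cubes `{(i, j, l) : l < T i j}` is invariant under the cyclic rotation of the three
coordinates. -/
def IsTSPP (m : ℕ) (T : Fin m → Fin m → Fin (m + 1)) : Prop :=
  (∀ i i' j, i ≤ i' → T i' j ≤ T i j) ∧
  (∀ i j j', j ≤ j' → T i j' ≤ T i j) ∧
  (∀ i j, T i j = T j i) ∧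
  (∀ i j l : Fin m, (l : ℕ) < T i j ↔ (i : ℕ) < T j l)

/-- The finite set `TSPP_m` of totally symmetric plane partitions inside the `(m, m, m)`-box. -/
def TSPP (m : ℕ) : Type := {T : Fin m → Fin m → Fin (m + 1) // IsTSPP m T}

namespace TSPP

variable {m : ℕ}

instance (m : ℕ) : Finite (TSPP m) := Subtype.finite

noncomputable instance (m : ℕ) : Fintype (TSPP m) := Fintype.ofFinite _

/-- The partition `(T_{1,1}, T_{2,2}, …, T_{m,m})`. -/
def diagRows (T : TSPP m) : YoungDiagram where
  cells := (Finset.range m ×ˢ Finset.range m).filter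
    (fun c => ∃ h : c.1 < m, c.2 < (T.1 ⟨c.1, h⟩ ⟨c.1, h⟩ : ℕ))
  isLowerSet := by
    rintro ⟨i, j⟩ ⟨i', j'⟩ hle hmem
    obtain ⟨hi, hj⟩ : i' ≤ i ∧ j' ≤ j := hle
    simp only [Finset.coe_filter, Finset.mem_product, Finset.mem_range, Set.mem_ofPred_eq] at hmem ⊢
    obtain ⟨⟨hbi, hbj⟩, h, hlt⟩ := hmem
    have h' : i' < m := by omega
    refine ⟨⟨h', by omega⟩, h', ?_⟩
    have h1 : T.1 ⟨i, h⟩ ⟨i, h⟩ ≤ T.1 ⟨i', h'⟩ ⟨i, h⟩ := T.2.1 _ _ _ hi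
    have h2 : T.1 ⟨i', h'⟩ ⟨i, h⟩ ≤ T.1 ⟨i', h'⟩ ⟨i', h'⟩ := T.2.2.1 _ _ _ hi
    have h3 : (T.1 ⟨i, h⟩ ⟨i, h⟩ : ℕ) ≤ T.1 ⟨i', h'⟩ ⟨i', h'⟩ := h1.trans h2
    omega

/-- `diag(T)`, the conjugate of the partition `(T_{1,1}, …, T_{m,m})`. -/
def diag (T : TSPP m) : YoungDiagram := T.diagRows.transpose

theorem mem_diag (T : TSPP m) (i j : ℕ) :
    (i, j) ∈ T.diag ↔ ∃ h : j < m, i < (T.1 ⟨j, h⟩ ⟨j, h⟩ : ℕ) := by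
  rw [diag, YoungDiagram.mem_transpose, ← YoungDiagram.mem_cells]
  simp only [diagRows, Prod.swap, Finset.mem_filter, Finset.mem_product, Finset.mem_range]
  constructor
  · rintro ⟨-, h⟩
    exact h
  · rintro ⟨h, hlt⟩
    exact ⟨⟨h, by have := (T.1 ⟨j, h⟩ ⟨j, h⟩).2; omega⟩, h, hlt⟩

/-- If `diag(T) = (a_1, …, a_d | b_1, …, b_d)`, then `a_i ≤ b_i`. -/
theorem arm_le_leg (T : TSPP m) (i : ℕ) (hi : (i, i) ∈ T.diag) :
    T.diag.arm i ≤ T.diag.leg i := by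
  have hr := YoungDiagram.mem_iff_lt_rowLen.1 hi
  have hlast : (i, T.diag.rowLen i - 1) ∈ T.diag :=
    YoungDiagram.mem_iff_lt_rowLen.2 (by omega)
  obtain ⟨him, -⟩ := (T.mem_diag _ _).1 hi
  obtain ⟨hq, hlt⟩ := (T.mem_diag _ _).1 hlast
  set q : Fin m := ⟨T.diag.rowLen i - 1, hq⟩ with hqd
  have hiq : (⟨i, him⟩ : Fin m) ≤ q := by
    show i ≤ T.diag.rowLen i - 1
    omega
  have h1 : ((q : Fin m) : ℕ) < T.1 q ⟨i, him⟩ := (T.2.2.2.2 q q ⟨i, him⟩).1 hlt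
  have h2 : T.1 q ⟨i, him⟩ ≤ T.1 ⟨i, him⟩ ⟨i, him⟩ := T.2.1 _ _ _ hiq
  have h3 : (T.1 q ⟨i, him⟩ : ℕ) ≤ T.1 ⟨i, him⟩ ⟨i, him⟩ := h2
  have h4 : ((q : ℕ), i) ∈ T.diag := (T.mem_diag _ _).2 ⟨him, by omega⟩
  have h5 := YoungDiagram.mem_iff_lt_colLen.1 h4
  have h6 : (q : ℕ) = T.diag.rowLen i - 1 := rfl
  simp only [YoungDiagram.arm, YoungDiagram.leg]
  omega

/-- `π_k(T) = (a_1, …, a_d | b_1 + k, …, b_d + k)` where `diag(T) = (a_1, …, a_d | b_1, …, b_d)`. -/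
def piPart (T : TSPP m) (k : ℤ) (hk : -1 ≤ k) : YoungDiagram :=
  T.diag.frobeniusShift k hk T.arm_le_leg

/-- The weight
`r^d u^{∑ (a_i + 1)} v^{binom (m+1) 2 - ∑ (b_i + 1)} w^{∑ (b_i - a_i)}` of `T ∈ TSPP_m`, where
`diag(T) = (a_1, …, a_d | b_1, …, b_d)`. No natural number subtraction truncates: `a_i ≤ b_i`,
and the `b_i + 1` are distinct elements of `{1, …, m}`. -/
def weight {R : Type*} [CommRing R] (T : TSPP m) (r u v w : R) : R :=
  r ^ T.diag.durfee *
  u ^ (∑ i ∈ Finset.range T.diag.durfee, (T.diag.arm i + 1)) *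
  v ^ ((m + 1).choose 2 - ∑ i ∈ Finset.range T.diag.durfee, (T.diag.leg i + 1)) *
  w ^ (∑ i ∈ Finset.range T.diag.durfee, (T.diag.leg i - T.diag.arm i))

end TSPP

/-- The symmetric generating function
`A_{n,k}(x_1, …, x_N; r, u, v, w) = ∑_{T ∈ TSPP_{n-1}} ω(T) s_{π_k(T)}(x_1, …, x_N)`
of totally symmetric plane partitions, for `n ≥ 1` and `k ≥ -1`. -/
noncomputable def tsppGenFun {R : Type*} [CommRing R] (n : ℕ) (k : ℤ) (hk : -1 ≤ k) (N : ℕ)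
    (r u v w : R) : MvPolynomial (Fin N) R :=
  ∑ T : TSPP (n - 1), MvPolynomial.C (T.weight r u v w) * schurPoly R N (T.piPart k hk)

/-! Each identity compares sums indexed by finite sets of leg lengths. A `k`-asymmetric diagram is
determined by its set of legs, and those with at most `n` rows correspond to the subsets of `[max k
0, n)` (`bijOn_legs`); diagrams with more rows have zero Schur polynomial in `n` variables.

For the product formulas, multiply by the Vandermonde determinant. The bialternant formula
(`det_mul_schurEval`, proved by matching the branching rule with elimination of the last variable)
turns each Schur polynomial into a determinant of powers. Its columns can be reordered so that
column `c` has exponent `n + c - k` if `c` is a leg and `n - 1 - c` otherwise, at the cost of a sign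
`(-1)^c` for each leg (`det_rowLen_eq`). The sum over leg sets is then the multilinear expansion of
one determinant whose columns have two terms (`det_mul_sum_schurEval`). After removing `x_i^(n-1)`
from row `i`, the columns satisfy a three-term recurrence in `z = 1/x - x` or `z = 1/x + x`, so they
are a common factor times monic polynomials in `z`. What remains is a Vandermonde determinant in
`z`, and each `z_j - z_i` factors into `x_i - x_j` and `1 ± x_i x_j` (`det_weyl`).

For the plane partitions, `w = 0` keeps only those whose diagonal partition is self-conjugate. Such
a `T` is determined by that partition, every self-conjugate partition with at most `m` rows occurs,
and thus these `T` correspond to subsets of `range m` (`TSPP.bijOn_legs_diag`). Passing to `π_k`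
shifts all legs by `k`. For `k = -1` the leg `0` disappears, so every set arises twice; this is the
factor `1/2`. -/

/-! ### Determinants of powers and Weyl-type denominators -/

open Matrix in
theorem det_sum_columns {R ι : Type*} [CommRing R] {n : ℕ} (S : Fin n → Finset ι)
    (A : Fin n → Fin n → ι → R) :
    det (of fun i j => ∑ p ∈ S j, A i j p) =
      ∑ m ∈ Fintype.piFinset S, det (of fun i j => A i j (m j)) := by
  have h := (detRowAlternating (n := Fin n) (R := R)).toMultilinearMap.map_sum_finset
    (fun j p i => A i j p) S
  rw [← det_transpose]
  refine Eq.trans ?_ (h.trans ?_)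
  · change det _ = det _
    congr 1
    ext i j
    simp [Finset.sum_apply]
  · refine Finset.sum_congr rfl fun m _ => ?_
    rw [← det_transpose]
    rfl

/-- A shifted geometric sum; in `det_pow_succ` it extracts `x i - x n` from the entries left after
column reduction. -/
theorem sub_mul_sum_Icc {R : Type*} [CommRing R] (x y : R) {a b : ℕ} (hab : a ≤ b) (k : ℕ) :
    (x - y) * ∑ p ∈ Finset.Icc a b, x ^ (p + k) * y ^ (b - p) =
      x ^ (b + (k + 1)) - y ^ (b - a + 1) * x ^ (a + k) := by
  have h := (Commute.all x y).geom_sum₂_mul (b - a + 1)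
  have e : ∑ p ∈ Finset.Icc a b, x ^ (p + k) * y ^ (b - p) =
      x ^ (a + k) * ∑ i ∈ Finset.range (b - a + 1), x ^ i * y ^ (b - a + 1 - 1 - i) := by
    rw [← Finset.Ico_add_one_right_eq_Icc, Finset.sum_Ico_eq_sum_range, Finset.mul_sum,
      show b + 1 - a = b - a + 1 by omega]
    refine Finset.sum_congr rfl fun i hi => ?_
    rw [show b - (a + i) = b - a + 1 - 1 - i by omega, show a + i + k = a + k + i by ring, pow_add]
    ring
  rw [e, mul_left_comm, mul_comm (x - y), h, show b + (k + 1) = a + k + (b - a + 1) by omega,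
    pow_add x (a + k)]
  ring

open Matrix in
/-- Elimination of the last variable in a generalized Vandermonde determinant. -/
theorem det_pow_succ {R : Type*} [CommRing R] (x : ℕ → R) (n : ℕ) (l : ℕ → ℕ) (hl : Antitone l) :
    det (of fun i j : Fin (n + 1) => x i ^ (l j + (n - j))) =
      x n ^ l n * ((∏ i : Fin n, (x i - x n)) *
        det (of fun i j : Fin n =>
          ∑ p ∈ Finset.Icc (l (j + 1)) (l j), x i ^ (p + (n - 1 - j)) * x n ^ (l j - p))) := by
  set A : Matrix (Fin (n + 1)) (Fin (n + 1)) R := of fun i j => x i ^ (l j + (n - j)) with hA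
  set B : Matrix (Fin (n + 1)) (Fin (n + 1)) R := of fun i j => x i ^ (l j + (n - j)) -
    if (j : ℕ) < n then x n ^ (l j - l (j + 1) + 1) * x i ^ (l (j + 1) + (n - 1 - j)) else 0 with hB
  have hAB : det A = det B := by
    -- Each column is reduced by a multiple of the next one; reversing the order makes this the
    -- preceding column, as the determinant lemma expects.
    rw [← det_submatrix_equiv_self Fin.revPerm A, ← det_submatrix_equiv_self Fin.revPerm B]
    refine det_eq_of_forall_col_eq_smul_add_pred
      (fun j => x n ^ (l (n - (j + 1)) - l (n - j) + 1)) ?_ ?_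
    · intro i
      simp [A, B]
    · intro i j
      have hj := j.2
      simp only [submatrix_apply, A, B, of_apply, Fin.revPerm_apply, Fin.val_rev, Fin.val_succ,
        Fin.val_castSucc]
      rw [if_pos (by omega), show n + 1 - (j + 1 + 1) = n - (j + 1) by omega,
        show n + 1 - ((j : ℕ) + 1) = n - j by omega, show n - ((j : ℕ) + 1) + 1 = n - j by omega,
        show n - 1 - (n - ((j : ℕ) + 1)) = n - (n - j) by omega]
      ring
  rw [hAB, det_succ_row B (Fin.last n), Finset.sum_eq_single (Fin.last n)]
  · have h1 : B (Fin.last n) (Fin.last n) = x n ^ l n := by simp [B]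
    have h2 : B.submatrix (Fin.last n).succAbove (Fin.last n).succAbove =
        of fun i j : Fin n => (x i - x n) * (of fun i j : Fin n =>
          ∑ p ∈ Finset.Icc (l (j + 1)) (l j), x i ^ (p + (n - 1 - j)) * x n ^ (l j - p)) i j := by
      ext i j
      have hj := j.2
      simp only [submatrix_apply, B, of_apply, Fin.succAbove_last, Fin.val_castSucc, hj, if_true]
      rw [sub_mul_sum_Icc _ _ (hl (Nat.le_succ _)), show n - 1 - (j : ℕ) + 1 = n - j by omega]
    rw [h1, h2, det_mul_column, ← two_mul, pow_mul]
    simp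
  · intro j _ hj
    have hj' : (j : ℕ) < n := by
      have := j.2
      have : (j : ℕ) ≠ n := fun h => hj (Fin.ext h)
      omega
    have hle : l (j + 1) ≤ l j := hl (Nat.le_succ _)
    -- In the last row the base is `x n` itself, so the subtracted term cancels the entry.
    have : B (Fin.last n) j = 0 := by
      simp only [B, of_apply, if_pos hj', Fin.val_last, ← pow_add]
      rw [show l j - l (j + 1) + 1 + (l (j + 1) + (n - 1 - (j : ℕ))) = l j + (n - j) by omega,
        sub_self]
    rw [this]
    ring
  · simp

-- By multilinearity, the terms are indexed by the sequences interlacing with `l`. This is the same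
-- index set and the same power of `x n` as in the branching rule `schurEval_succ`.
open Matrix in
theorem det_pow_succ_expand {R : Type*} [CommRing R] (x : ℕ → R) (n : ℕ) (l : ℕ → ℕ)
    (hl : Antitone l) :
    det (of fun i j : Fin (n + 1) => x i ^ (l j + (n - j))) =
      (∏ i : Fin n, (x i - x n)) *
        ∑ m ∈ Fintype.piFinset fun j : Fin n => Finset.Icc (l (j + 1)) (l j),
          x n ^ (l n + ∑ j : Fin n, (l j - m j)) *
            det (of fun i j : Fin n => x i ^ (m j + (n - 1 - j))) := by
  rw [det_pow_succ x n l hl, det_sum_columns, mul_left_comm]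
  congr 1
  rw [Finset.mul_sum]
  refine Finset.sum_congr rfl fun m _ => ?_
  have := det_mul_row (fun j : Fin n => x n ^ (l j - m j))
    (of fun i j : Fin n => x i ^ (m j + (n - 1 - j)))
  simp only [of_apply] at this
  simp only [mul_comm (_ ^ (m _ + _))]
  rw [this, Finset.prod_pow_eq_pow_sum, pow_add, mul_assoc]

open Matrix in
theorem det_pow_rev_succ {R : Type*} [CommRing R] (x : ℕ → R) (n : ℕ) :
    det (of fun i j : Fin (n + 1) => x i ^ (n - (j : ℕ))) =
      (∏ i : Fin n, (x i - x n)) * det (of fun i j : Fin n => x i ^ (n - 1 - (j : ℕ))) := by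
  have := det_pow_succ x n (fun _ => 0) antitone_const
  simpa using this

-- The recurrence makes `q c` equal to `h` times a monic polynomial of degree `c` in `z`, and monic
-- polynomials of degrees `0, …, n - 1` have the Vandermonde determinant. The parameters `β` and `α`
-- only affect lower-order terms.
open Matrix Polynomial in
theorem det_three_term {K : Type*} [Field K] {n : ℕ} (z h : Fin n → K) (q : ℕ → Fin n → K)
    (β : K) (α : ℕ → K) (h0 : ∀ i, q 0 i = h i) (h1 : ∀ i, q 1 i = (z i + β) * q 0 i)
    (h2 : ∀ c i, q (c + 2) i = z i * q (c + 1) i + α c * q c i) :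
    det (of fun i c : Fin n => q c i) = (∏ i, h i) * ∏ i, ∏ j ∈ Finset.Ioi i, (z j - z i) := by
  have key : ∀ c : ℕ, ∃ P : K[X], P.Monic ∧ P.natDegree = c ∧ ∀ i, q c i = h i * P.eval (z i) := by
    have : ∀ c : ℕ, (∃ P : K[X], P.Monic ∧ P.natDegree = c ∧ ∀ i, q c i = h i * P.eval (z i)) ∧
        ∃ P : K[X], P.Monic ∧ P.natDegree = c + 1 ∧ ∀ i, q (c + 1) i = h i * P.eval (z i) := by
      intro c
      induction c with
      | zero =>
        refine ⟨⟨1, monic_one, natDegree_one, fun i => by simp [h0]⟩,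
          ⟨X + C β, monic_X_add_C β, natDegree_X_add_C β, fun i => ?_⟩⟩
        simp [h1, h0, mul_comm]
      | succ c ih =>
        obtain ⟨⟨P, hP, hPd, hPe⟩, ⟨Q, hQ, hQd, hQe⟩⟩ := ih
        refine ⟨⟨Q, hQ, hQd, hQe⟩, ⟨X * Q + C (α c) * P, ?_, ?_, fun i => ?_⟩⟩
        · refine (monic_X.mul hQ).add_of_left (degree_lt_degree ?_)
          refine (natDegree_C_mul_le _ _).trans_lt ?_
          rw [natDegree_mul X_ne_zero hQ.ne_zero, natDegree_X, hQd, hPd]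
          omega
        · rw [natDegree_add_eq_left_of_natDegree_lt, natDegree_mul X_ne_zero hQ.ne_zero, natDegree_X,
            hQd, add_comm]
          refine (natDegree_C_mul_le _ _).trans_lt ?_
          rw [natDegree_mul X_ne_zero hQ.ne_zero, natDegree_X, hQd, hPd]
          omega
        · rw [h2, hPe, hQe]
          simp
          ring
    exact fun c => (this c).1
  choose P hP hPd hPe using key
  have := det_eval_matrixOfPolynomials_eq_det_vandermonde z (fun c => P c) (fun c => hPd c)
    (fun c => hP c)
  rw [det_vandermonde] at this
  rw [this, ← det_mul_column]
  congr 1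
  ext i c
  simp [hPe]

theorem prod_Ioi_mul_eq_prod_pow {R : Type*} [CommRing R] {n : ℕ} (x : Fin n → R) :
    ∏ i, ∏ j ∈ Finset.Ioi i, (x i * x j) = ∏ i, x i ^ (n - 1) := by
  have := Finset.prod_prod_Ioi_mul_eq_prod_prod_off_diag (fun i _ : Fin n => x i)
  refine (Finset.prod_congr rfl fun i _ => Finset.prod_congr rfl fun j _ =>
    mul_comm _ _).trans (this.trans ?_)
  rw [Finset.prod_comm' (t' := Finset.univ) (s' := fun i => {i}ᶜ)]
  · simp [Finset.card_compl]
  · simp [eq_comm]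

open Matrix in
theorem det_pow_rev {R : Type*} [CommRing R] {n : ℕ} (x : Fin n → R) :
    det (of fun i j : Fin n => x i ^ (n - 1 - (j : ℕ))) = ∏ i, ∏ j ∈ Finset.Ioi i, (x i - x j) := by
  have := det_projVandermonde (fun _ => 1) x
  simp only [one_mul] at this
  rw [← this]
  congr 1
  ext i j
  simp [projVandermonde_apply, Fin.val_rev, Nat.sub_sub, add_comm]

open Matrix in
/-- The common shape of the Weyl denominator formulas of the classical types. -/
theorem det_weyl {K : Type*} [Field K] {n : ℕ} (x z h : Fin n → K) (ε : K)
    (hz : ∀ i j, (x i * x j) * (z j - z i) = (x i - x j) * (1 + ε * (x i * x j)))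
    (q : ℕ → Fin n → K) (β : K) (α : ℕ → K)
    (h0 : ∀ i, q 0 i = h i) (h1 : ∀ i, q 1 i = (z i + β) * q 0 i)
    (h2 : ∀ c i, q (c + 2) i = z i * q (c + 1) i + α c * q c i) :
    det (of fun i c : Fin n => x i ^ (n - 1) * q c i) =
      det (of fun i j : Fin n => x i ^ (n - 1 - (j : ℕ))) *
        ((∏ i, h i) * ∏ i, ∏ j ∈ Finset.Ioi i, (1 + ε * (x i * x j))) := by
  have := det_mul_column (fun i => x i ^ (n - 1)) (of fun i c : Fin n => q c i)
  simp only [of_apply] at this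
  -- The row factors `x i ^ (n - 1)` are distributed as one `x i * x j` per pair, which is what `hz`
  -- needs to clear the denominators of `z j - z i`.
  rw [this, det_three_term z h q β α h0 h1 h2, ← prod_Ioi_mul_eq_prod_pow, det_pow_rev,
    mul_left_comm, mul_left_comm (∏ i, ∏ j ∈ Finset.Ioi i, (x i - x j))]
  congr 1
  simp only [← Finset.prod_mul_distrib, hz]

/-! ### Branching rule and bialternant formula -/

/-- The Schur polynomial of `μ` in `N` variables, evaluated at `x 0, …, x (N - 1)`. -/
noncomputable def schurEval {R : Type*} [CommRing R] (x : ℕ → R) (N : ℕ) (μ : YoungDiagram) : R :=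
  ∑ T : BoundedSSYT μ N, ∏ c ∈ μ.cells, x (T.1 c.1 c.2)

/-- Values indexed by `ℕ` let the induction on the number of variables drop the last one without
reindexing; this is the passage from polynomials to such values. -/
theorem map_schurPoly {R S : Type*} [CommRing R] [CommRing S] (N : ℕ) (μ : YoungDiagram)
    (φ : MvPolynomial (Fin N) R →+* S) (x : ℕ → S)
    (hx : ∀ i : Fin N, x i = φ (MvPolynomial.X i)) :
    φ (schurPoly R N μ) = schurEval x N μ := by
  simp only [schurPoly, schurEval, map_sum, map_prod]
  refine Finset.sum_congr rfl fun T _ => ?_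
  rw [← Finset.prod_coe_sort μ.cells]
  exact Finset.prod_congr rfl fun c _ => (hx _).symm

namespace YoungDiagram

/-- The diagram whose rows are the running minima of `m`. -/
def ofRows {n : ℕ} (m : Fin n → ℕ) : YoungDiagram where
  -- Running minima give a diagram for every `m`, so a sum over all `m` in a `Fintype.piFinset`
  -- needs no monotonicity proof. The sum of `m` is only a bound on the columns.
  cells := (Finset.range n ×ˢ Finset.range (∑ j, m j)).filter
    (fun c => ∀ k : Fin n, (k : ℕ) ≤ c.1 → c.2 < m k)
  isLowerSet := by
    rintro ⟨i, j⟩ ⟨i', j'⟩ hle hmem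
    obtain ⟨hi, hj⟩ : i' ≤ i ∧ j' ≤ j := hle
    simp only [Finset.coe_filter, Finset.mem_product, Finset.mem_range, Set.mem_ofPred_eq] at hmem ⊢
    obtain ⟨⟨hbi, hbj⟩, h⟩ := hmem
    exact ⟨⟨by omega, by omega⟩, fun k hk => lt_of_le_of_lt hj (h k (hk.trans hi))⟩

theorem mem_ofRows {n : ℕ} {m : Fin n → ℕ} (i j : ℕ) :
    (i, j) ∈ ofRows m ↔ i < n ∧ ∀ k : Fin n, (k : ℕ) ≤ i → j < m k := by
  rw [← mem_cells]
  simp only [ofRows, Finset.mem_filter, Finset.mem_product, Finset.mem_range]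
  refine ⟨fun h => ⟨h.1.1, h.2⟩, fun h => ⟨⟨h.1, ?_⟩, h.2⟩⟩
  exact (h.2 ⟨i, h.1⟩ le_rfl).trans_le
    (Finset.single_le_sum (f := m) (fun _ _ => Nat.zero_le _) (Finset.mem_univ _))

theorem rowLen_eq_iff {μ : YoungDiagram} {i a : ℕ} :
    μ.rowLen i = a ↔ ∀ j, (i, j) ∈ μ ↔ j < a := by
  simp only [mem_iff_lt_rowLen]
  refine ⟨fun h j => by rw [h], fun h => ?_⟩
  have h1 := h a
  have h2 := h (μ.rowLen i)
  omega

theorem mem_ofRows_of_antitone {n : ℕ} {m : Fin n → ℕ} (hm : Antitone m) (i j : ℕ) :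
    (i, j) ∈ ofRows m ↔ ∃ h : i < n, j < m ⟨i, h⟩ := by
  rw [mem_ofRows]
  exact ⟨fun h => ⟨h.1, h.2 ⟨i, h.1⟩ le_rfl⟩, fun ⟨h, h'⟩ => ⟨h, fun k hk => h'.trans_le (hm hk)⟩⟩

theorem rowLen_ofRows {n : ℕ} {m : Fin n → ℕ} (hm : Antitone m) (i : Fin n) :
    (ofRows m).rowLen i = m i := by
  rw [rowLen_eq_iff]
  intro j
  rw [mem_ofRows_of_antitone hm]
  simp

theorem rowLen_ofRows_eq_zero {n : ℕ} {m : Fin n → ℕ} : (ofRows m).rowLen n = 0 := by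
  rw [rowLen_eq_iff]
  simp [mem_ofRows]

theorem eq_ofRows {n : ℕ} {m : Fin n → ℕ} (hm : Antitone m) {μ : YoungDiagram}
    (h : ∀ i : Fin n, μ.rowLen i = m i) (h0 : μ.rowLen n = 0) : μ = ofRows m := by
  ext ⟨i, j⟩
  rw [mem_cells, mem_cells, mem_ofRows_of_antitone hm, mem_iff_lt_rowLen]
  constructor
  · intro hj
    have hi : i < n := by
      by_contra hi
      have := μ.rowLen_anti n i (by omega)
      omega
    exact ⟨hi, by rwa [← h]⟩
  · rintro ⟨hi, hj⟩
    rwa [← h] at hj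

theorem card_eq_sum_rowLen {n : ℕ} {μ : YoungDiagram} (h0 : μ.rowLen n = 0) :
    μ.cells.card = ∑ i : Fin n, μ.rowLen i := by
  rw [Fin.sum_univ_eq_sum_range, Finset.card_eq_sum_card_fiberwise (f := Prod.fst)
    (t := Finset.range n)]
  · exact Finset.sum_congr rfl fun i _ => (μ.rowLen_eq_card).symm
  · rintro ⟨i, j⟩ hij
    simp only [Finset.mem_coe, mem_cells, mem_iff_lt_rowLen] at hij
    simp only [Finset.coe_range, Set.mem_Iio]
    by_contra hi
    have := μ.rowLen_anti n i (by omega)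
    omega

end YoungDiagram

namespace BoundedSSYT

variable {μ ν : YoungDiagram} {n : ℕ}

/-- The subdiagram of the cells of `T` whose entry is less than `n`. -/
def sub (T : BoundedSSYT μ (n + 1)) : YoungDiagram where
  cells := μ.cells.filter fun c => T.1 c.1 c.2 < n
  isLowerSet := by
    rintro ⟨i, j⟩ ⟨i', j'⟩ hle hmem
    obtain ⟨hi, hj⟩ : i' ≤ i ∧ j' ≤ j := hle
    simp only [Finset.coe_filter, YoungDiagram.mem_cells, Set.mem_ofPred_eq] at hmem ⊢
    have h1 := μ.up_left_mem hi hj hmem.1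
    have h2 := T.1.row_weak_of_le hj (μ.up_left_mem hi le_rfl hmem.1)
    have h3 := T.1.col_weak hi hmem.1
    exact ⟨h1, by omega⟩

theorem mem_sub (T : BoundedSSYT μ (n + 1)) (i j : ℕ) :
    (i, j) ∈ T.sub ↔ (i, j) ∈ μ ∧ T.1 i j < n := by
  rw [← YoungDiagram.mem_cells]
  simp [sub]

/-- The restriction of `T` to its entries less than `n`. -/
def restrict (T : BoundedSSYT μ (n + 1)) (h : T.sub = ν) : BoundedSSYT ν n where
  val :=
    { entry := fun i j => if (i, j) ∈ ν then T.1 i j else 0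
      row_weak' := by
        intro i j1 j2 hj hm
        rw [if_pos hm, if_pos (ν.up_left_mem le_rfl hj.le hm)]
        subst h
        exact T.1.row_weak hj ((T.mem_sub _ _).1 hm).1
      col_strict' := by
        intro i1 i2 j hi hm
        rw [if_pos hm, if_pos (ν.up_left_mem hi.le le_rfl hm)]
        subst h
        exact T.1.col_strict hi ((T.mem_sub _ _).1 hm).1
      zeros' := fun h => if_neg h }
  property := by
    rintro ⟨i, j⟩ hc
    rw [YoungDiagram.mem_cells] at hc
    change (if (i, j) ∈ ν then T.1 i j else 0) < n
    rw [if_pos hc]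
    subst h
    exact ((T.mem_sub _ _).1 hc).2

theorem restrict_apply (T : BoundedSSYT μ (n + 1)) (h : T.sub = ν) (i j : ℕ) :
    (T.restrict h).1 i j = if (i, j) ∈ ν then T.1 i j else 0 := rfl

/-- The extension of `T` to a larger shape by the entry `n`. -/
def extend (T : BoundedSSYT ν n) (h : ν ≤ μ)
    (hs : ∀ i1 i2 j, i1 < i2 → (i2, j) ∈ μ → (i1, j) ∈ ν) : BoundedSSYT μ (n + 1) where
  val :=
    { entry := fun i j => if (i, j) ∈ ν then T.1 i j else if (i, j) ∈ μ then n else 0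
      row_weak' := by
        intro i j1 j2 hj hm
        by_cases h2 : (i, j2) ∈ ν
        · rw [if_pos h2, if_pos (ν.up_left_mem le_rfl hj.le h2)]
          exact T.1.row_weak hj h2
        · rw [if_neg h2, if_pos hm]
          split_ifs with h1
          · exact (T.2 _ ((YoungDiagram.mem_cells _).2 h1)).le
          · exact le_rfl
          · exact Nat.zero_le _
      col_strict' := by
        intro i1 i2 j hi hm
        have h1 := hs _ _ _ hi hm
        rw [if_pos h1]
        by_cases h2 : (i2, j) ∈ ν
        · rw [if_pos h2]
          exact T.1.col_strict hi h2
        · rw [if_neg h2, if_pos hm]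
          exact T.2 _ ((YoungDiagram.mem_cells _).2 h1)
      zeros' := fun h' => by rw [if_neg (fun h1 => h' (h h1)), if_neg h'] }
  property := by
    rintro ⟨i, j⟩ hc
    rw [YoungDiagram.mem_cells] at hc
    change (if (i, j) ∈ ν then T.1 i j else if (i, j) ∈ μ then n else 0) < n + 1
    rw [if_pos hc]
    split_ifs with h1
    · exact (T.2 _ ((YoungDiagram.mem_cells _).2 h1)).trans (Nat.lt_succ_self n)
    · exact Nat.lt_succ_self n

theorem extend_apply (T : BoundedSSYT ν n) (h : ν ≤ μ)
    (hs : ∀ i1 i2 j, i1 < i2 → (i2, j) ∈ μ → (i1, j) ∈ ν) (i j : ℕ) :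
    (T.extend h hs).1 i j = if (i, j) ∈ ν then T.1 i j else if (i, j) ∈ μ then n else 0 := rfl

theorem ext {T T' : BoundedSSYT μ n} (h : ∀ i j, (i, j) ∈ μ → T.1 i j = T'.1 i j) : T = T' := by
  refine Subtype.ext (SemistandardYoungTableau.ext fun i j => ?_)
  by_cases hm : (i, j) ∈ μ
  · exact h i j hm
  · rw [T.1.zeros hm, T'.1.zeros hm]

theorem sub_extend (T : BoundedSSYT ν n) (h : ν ≤ μ)
    (hs : ∀ i1 i2 j, i1 < i2 → (i2, j) ∈ μ → (i1, j) ∈ ν) : (T.extend h hs).sub = ν := by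
  ext ⟨i, j⟩
  rw [YoungDiagram.mem_cells, YoungDiagram.mem_cells, mem_sub, extend_apply]
  by_cases h1 : (i, j) ∈ ν
  · rw [if_pos h1]
    exact ⟨fun _ => h1, fun _ => ⟨h h1, T.2 _ ((YoungDiagram.mem_cells _).2 h1)⟩⟩
  · rw [if_neg h1]
    refine ⟨fun h2 => ?_, fun h2 => absurd h2 h1⟩
    rw [if_pos h2.1] at h2
    exact absurd h2.2 (lt_irrefl n)

-- `restrict` and `extend` are mutually inverse, and every cell outside `ν` carries the entry `n`.
-- The hypothesis `hs` says that `μ / ν` is a horizontal strip.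
open Classical in
theorem sum_sub_eq {R : Type*} [CommRing R] (x : ℕ → R) (h : ν ≤ μ)
    (hs : ∀ i1 i2 j, i1 < i2 → (i2, j) ∈ μ → (i1, j) ∈ ν) :
    ∑ T : BoundedSSYT μ (n + 1) with T.sub = ν, ∏ c ∈ μ.cells, x (T.1 c.1 c.2) =
      x n ^ (μ.cells.card - ν.cells.card) * schurEval x n ν := by
  have hsub : ν.cells ⊆ μ.cells := h
  rw [schurEval, Finset.mul_sum]
  refine Finset.sum_bij' (fun T hT => T.restrict (Finset.mem_filter.1 hT).2)
    (fun T _ => T.extend h hs) (fun _ _ => Finset.mem_univ _)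
    (fun T _ => Finset.mem_filter.2 ⟨Finset.mem_univ _, sub_extend T h hs⟩) ?_ ?_ ?_
  · intro T hT
    have hT' := (Finset.mem_filter.1 hT).2
    refine ext fun i j hm => ?_
    rw [extend_apply, restrict_apply]
    by_cases h1 : (i, j) ∈ ν
    · rw [if_pos h1, if_pos h1]
    · rw [if_neg h1, if_pos hm]
      have h2 := T.2 _ ((YoungDiagram.mem_cells _).2 hm)
      have h3 : ¬ T.1 i j < n := fun h3 => h1 (hT' ▸ (T.mem_sub i j).2 ⟨hm, h3⟩)
      simp only at h2
      omega
  · intro T _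
    refine ext fun i j hm => ?_
    rw [restrict_apply, if_pos hm, extend_apply, if_pos hm]
  · intro T hT
    have hT' := (Finset.mem_filter.1 hT).2
    rw [← Finset.prod_sdiff hsub]
    congr 1
    · rw [← Finset.card_sdiff_of_subset hsub, ← Finset.prod_const]
      refine Finset.prod_congr rfl ?_
      rintro ⟨i, j⟩ hc
      rw [Finset.mem_sdiff, YoungDiagram.mem_cells, YoungDiagram.mem_cells] at hc
      have h2 := T.2 _ ((YoungDiagram.mem_cells _).2 hc.1)
      have h3 : ¬ T.1 i j < n := fun h3 => hc.2 (hT' ▸ (T.mem_sub i j).2 ⟨hc.1, h3⟩)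
      simp only at h2 ⊢
      congr 1
      omega
    · refine Finset.prod_congr rfl ?_
      rintro ⟨i, j⟩ hc
      rw [restrict_apply, if_pos ((YoungDiagram.mem_cells _).1 hc)]

end BoundedSSYT

open YoungDiagram BoundedSSYT in
/-- The branching rule: the restriction of a Schur polynomial is a sum over interlacing rows. -/
theorem schurEval_succ {R : Type*} [CommRing R] (x : ℕ → R) (n : ℕ) (μ : YoungDiagram)
    (h0 : μ.rowLen (n + 1) = 0) :
    schurEval x (n + 1) μ =
      ∑ m ∈ Fintype.piFinset fun j : Fin n => Finset.Icc (μ.rowLen (j + 1)) (μ.rowLen j),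
        x n ^ (μ.rowLen n + ∑ j : Fin n, (μ.rowLen j - m j)) * schurEval x n (ofRows m) := by
  classical
  -- Strict columns allow the largest entry `n` only at the bottom of a column.
  have hrow : ∀ T : BoundedSSYT μ (n + 1), ∀ i1 i2 j, i1 < i2 → (i2, j) ∈ μ → (i1, j) ∈ T.sub := by
    intro T i1 i2 j hi hm
    have h1 := T.1.col_strict hi hm
    have h2 := T.2 _ ((mem_cells _).2 hm)
    simp only at h2
    exact (T.mem_sub _ _).2 ⟨μ.up_left_mem hi.le le_rfl hm, by omega⟩
  have hle : ∀ T : BoundedSSYT μ (n + 1), T.sub ≤ μ := fun T c hc => ((T.mem_sub c.1 c.2).1 hc).1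
  have hsubn : ∀ T : BoundedSSYT μ (n + 1), T.sub.rowLen n = 0 := by
    intro T
    rw [rowLen_eq_iff]
    intro j
    rw [mem_sub]
    simp only [Nat.not_lt_zero, iff_false]
    rintro ⟨hm, hlt⟩
    -- Strict columns force entries in row `i` to be at least `i`, so row `n` has no entry below
    -- `n`.
    have key : ∀ i, i ≤ n → i ≤ T.1 i j := by
      intro i
      induction i with
      | zero => intro; omega
      | succ i ih =>
        intro hi
        have h1 := ih (by omega)
        have h2 := T.1.col_strict (Nat.lt_add_one i) (μ.up_left_mem hi le_rfl hm)
        omega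
    have := key n le_rfl
    omega
  rw [schurEval, ← Finset.sum_fiberwise_of_maps_to (g := fun T : BoundedSSYT μ (n + 1) =>
    fun j : Fin n => T.sub.rowLen j) (t := Fintype.piFinset fun j : Fin n =>
      Finset.Icc (μ.rowLen (j + 1)) (μ.rowLen j))]
  · refine Finset.sum_congr rfl fun m hm => ?_
    simp only [Fintype.mem_piFinset, Finset.mem_Icc] at hm
    have hanti : Antitone m := by
      intro i j hij
      rcases hij.eq_or_lt with rfl | hlt
      · exact le_rfl
      · exact ((hm j).2.trans (μ.rowLen_anti (i + 1) j hlt)).trans (hm i).1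
    have hν : ofRows m ≤ μ := by
      rintro ⟨i, j⟩ hij
      obtain ⟨hi, hj⟩ := (mem_ofRows_of_antitone hanti i j).1 hij
      exact mem_iff_lt_rowLen.2 (hj.trans_le (hm ⟨i, hi⟩).2)
    have hs : ∀ i1 i2 j, i1 < i2 → (i2, j) ∈ μ → (i1, j) ∈ ofRows m := by
      intro i1 i2 j hi hmem
      have hi2 : i2 < n + 1 := by
        by_contra hi2
        have h1 := μ.rowLen_anti (n + 1) i2 (by omega)
        have h2 := mem_iff_lt_rowLen.1 hmem
        omega
      refine (mem_ofRows_of_antitone hanti i1 j).2 ⟨by omega, ?_⟩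
      have h1 := (hm ⟨i1, by omega⟩).1
      have h2 := μ.rowLen_anti (i1 + 1) i2 hi
      have h3 := mem_iff_lt_rowLen.1 hmem
      simp only at h1
      omega
    have hcard : μ.cells.card - (ofRows m).cells.card =
        μ.rowLen n + ∑ j : Fin n, (μ.rowLen j - m j) := by
      rw [card_eq_sum_rowLen h0, card_eq_sum_rowLen (n := n) rowLen_ofRows_eq_zero,
        Fin.sum_univ_castSucc]
      simp only [Fin.val_castSucc, Fin.val_last, rowLen_ofRows hanti]
      rw [Finset.sum_tsub_distrib _ fun j _ => (hm j).2]
      have : ∑ j, m j ≤ ∑ j : Fin n, μ.rowLen j := Finset.sum_le_sum fun j _ => (hm j).2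
      omega
    rw [← hcard, ← sum_sub_eq x hν hs]
    refine Finset.sum_congr (Finset.filter_congr fun T _ => ?_) fun _ _ => rfl
    constructor
    · intro hT
      exact eq_ofRows hanti (fun i => congrFun hT i) (hsubn T)
    · intro hT
      funext j
      rw [hT, rowLen_ofRows hanti]
  · intro T _
    refine Finset.mem_coe.2 (Fintype.mem_piFinset.2 fun j => Finset.mem_Icc.2 ?_)
    refine ⟨?_, ?_⟩
    · by_contra hlt
      push Not at hlt
      have := hrow T j (j + 1) (T.sub.rowLen j) (Nat.lt_succ_self _) (mem_iff_lt_rowLen.2 hlt)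
      exact lt_irrefl _ (mem_iff_lt_rowLen.1 this)
    · by_contra hlt
      push Not at hlt
      exact lt_irrefl _ (mem_iff_lt_rowLen.1 (hle T (mem_iff_lt_rowLen.2 hlt)))

open Matrix in
/-- The bialternant formula for Schur polynomials. -/
theorem det_mul_schurEval {R : Type*} [CommRing R] (x : ℕ → R) (n : ℕ) (μ : YoungDiagram)
    (h0 : μ.rowLen n = 0) :
    det (of fun i j : Fin n => x i ^ (n - 1 - (j : ℕ))) * schurEval x n μ =
      det (of fun i j : Fin n => x i ^ (μ.rowLen j + (n - 1 - j))) := by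
  induction n generalizing μ with
  | zero =>
    have hμ : ∀ i j, (i, j) ∉ μ := by
      intro i j h
      have h1 := YoungDiagram.mem_iff_lt_rowLen.1 h
      have h2 := μ.rowLen_anti 0 i (Nat.zero_le _)
      omega
    have hc : μ.cells = ∅ := Finset.eq_empty_of_forall_notMem fun c hc => hμ c.1 c.2 hc
    have : Unique (BoundedSSYT μ 0) :=
      { default := ⟨SemistandardYoungTableau.highestWeight μ, by simp [hc]⟩
        uniq := fun T => BoundedSSYT.ext fun i j h => absurd h (hμ i j) }
    simp [schurEval, hc]
  | succ n ih =>
    simp only [Nat.add_sub_cancel]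
    -- After the common factor `∏ (x i - x n)` is removed, both sides obey the same recursion over
    -- interlacing rows.
    rw [det_pow_rev_succ, det_pow_succ_expand x n μ.rowLen (fun _ _ h => μ.rowLen_anti _ _ h),
      schurEval_succ x n μ h0, mul_assoc]
    congr 1
    rw [Finset.mul_sum]
    refine Finset.sum_congr rfl fun m hm => ?_
    simp only [Fintype.mem_piFinset, Finset.mem_Icc] at hm
    have hanti : Antitone m := by
      intro i j hij
      rcases hij.eq_or_lt with rfl | hlt
      · exact le_rfl
      · exact ((hm j).2.trans (μ.rowLen_anti (i + 1) j hlt)).trans (hm i).1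
    rw [mul_left_comm, ih _ YoungDiagram.rowLen_ofRows_eq_zero]
    simp only [YoungDiagram.rowLen_ofRows hanti]

/-! ### Frobenius notation and sets of leg lengths -/

namespace YoungDiagram

variable (μ ν : YoungDiagram)

theorem durfee_eq_of_forall {d : ℕ} (h : ∀ i, (i, i) ∈ μ ↔ i < d) : μ.durfee = d := by
  have : μ.cells.filter (fun c => c.1 = c.2) = (Finset.range d).image fun i => (i, i) := by
    ext ⟨i, j⟩
    simp only [Finset.mem_filter, mem_cells, Finset.mem_image, Finset.mem_range, Prod.mk.injEq]
    constructor
    · rintro ⟨hm, rfl⟩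
      exact ⟨i, (h i).1 hm, rfl, rfl⟩
    · rintro ⟨t, ht, rfl, rfl⟩
      exact ⟨(h t).2 ht, rfl⟩
  rw [durfee, this, Finset.card_image_of_injective _ fun a b hab => (Prod.mk.inj hab).1,
    Finset.card_range]

theorem diag_mem_iff (i : ℕ) : (i, i) ∈ μ ↔ i < μ.durfee := by
  have hex : ∃ i, (i, i) ∉ μ := by
    refine ⟨μ.rowLen 0, fun h => ?_⟩
    have h1 := mem_iff_lt_rowLen.1 h
    have h2 := μ.rowLen_anti 0 (μ.rowLen 0) (Nat.zero_le _)
    omega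
  classical
  have h : ∀ i, (i, i) ∈ μ ↔ i < Nat.find hex := by
    intro i
    rw [Nat.lt_find_iff]
    exact ⟨fun h m hm => not_not.2 (μ.up_left_mem hm hm h), fun h => not_not.1 (h i le_rfl)⟩
  rw [μ.durfee_eq_of_forall h, h]

variable {μ ν}

theorem lt_rowLen_of_lt_durfee {i : ℕ} (h : i < μ.durfee) : i < μ.rowLen i :=
  mem_iff_lt_rowLen.1 ((μ.diag_mem_iff i).2 h)

theorem lt_colLen_of_lt_durfee {i : ℕ} (h : i < μ.durfee) : i < μ.colLen i :=
  mem_iff_lt_colLen.1 ((μ.diag_mem_iff i).2 h)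

theorem rowLen_le_of_durfee_le {i : ℕ} (h : μ.durfee ≤ i) : μ.rowLen i ≤ i := by
  by_contra hlt
  have := (μ.diag_mem_iff i).1 (mem_iff_lt_rowLen.2 (not_le.1 hlt))
  omega

theorem mem_iff_le_arm {i j : ℕ} (hij : i ≤ j) :
    (i, j) ∈ μ ↔ i < μ.durfee ∧ j ≤ i + μ.arm i := by
  rw [← diag_mem_iff]
  constructor
  · intro h
    have h1 := mem_iff_lt_rowLen.1 h
    exact ⟨μ.up_left_mem le_rfl hij h, by rw [arm]; omega⟩
  · rintro ⟨h, hj⟩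
    have h1 := mem_iff_lt_rowLen.1 h
    rw [arm] at hj
    exact mem_iff_lt_rowLen.2 (by omega)

theorem mem_iff_le_leg {i j : ℕ} (hij : j ≤ i) :
    (i, j) ∈ μ ↔ j < μ.durfee ∧ i ≤ j + μ.leg j := by
  rw [← diag_mem_iff]
  constructor
  · intro h
    have h1 := mem_iff_lt_colLen.1 h
    exact ⟨μ.up_left_mem hij le_rfl h, by rw [leg]; omega⟩
  · rintro ⟨h, hj⟩
    have h1 := mem_iff_lt_colLen.1 h
    rw [leg] at hj
    exact mem_iff_lt_colLen.2 (by omega)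

theorem arm_eq_of_forall {i a : ℕ} (hi : i < μ.durfee)
    (h : ∀ j, i ≤ j → ((i, j) ∈ μ ↔ j ≤ i + a)) : μ.arm i = a := by
  have h1 := (h (i + a) (by omega)).2 le_rfl
  have h2 := (h (i + μ.arm i) (by omega)).1 ((mem_iff_le_arm (by omega)).2 ⟨hi, le_rfl⟩)
  have h3 := ((mem_iff_le_arm (by omega)).1 h1).2
  omega

theorem leg_eq_of_forall {j b : ℕ} (hj : j < μ.durfee)
    (h : ∀ i, j ≤ i → ((i, j) ∈ μ ↔ i ≤ j + b)) : μ.leg j = b := by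
  have h1 := (h (j + b) (by omega)).2 le_rfl
  have h2 := (h (j + μ.leg j) (by omega)).1 ((mem_iff_le_leg (by omega)).2 ⟨hj, le_rfl⟩)
  have h3 := ((mem_iff_le_leg (by omega)).1 h1).2
  omega

theorem leg_lt_leg {i j : ℕ} (hij : i < j) (hj : j < μ.durfee) : μ.leg j < μ.leg i := by
  have h1 := lt_colLen_of_lt_durfee hj
  have h2 := μ.colLen_anti i j hij.le
  simp only [leg]
  omega

/-- A Young diagram is determined by its Frobenius notation. -/
theorem ext_frobenius (hd : μ.durfee = ν.durfee) (ha : ∀ i < μ.durfee, μ.arm i = ν.arm i)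
    (hl : ∀ i < μ.durfee, μ.leg i = ν.leg i) : μ = ν := by
  ext ⟨i, j⟩
  rw [mem_cells, mem_cells]
  rcases le_total i j with h | h
  · rw [mem_iff_le_arm h, mem_iff_le_arm h, ← hd]
    exact and_congr_right fun hi => by rw [ha i hi]
  · rw [mem_iff_le_leg h, mem_iff_le_leg h, ← hd]
    exact and_congr_right fun hi => by rw [hl j hi]

/-- The Young diagram with Frobenius notation `(a 0, …, a (d - 1) | b 0, …, b (d - 1))`. -/
def frobenius (d : ℕ) (a b : ℕ → ℕ) (ha : ∀ i j, i < j → j < d → a j < a i)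
    (hb : ∀ i j, i < j → j < d → b j < b i) : YoungDiagram where
  cells := (Finset.range (d + a 0 + b 0) ×ˢ Finset.range (d + a 0 + b 0)).filter
    fun c => min c.1 c.2 < d ∧ c.2 ≤ c.1 + a (min c.1 c.2) ∧ c.1 ≤ c.2 + b (min c.1 c.2)
  isLowerSet := by
    -- Strict decrease of `a` is weak decrease of `a i + i`, that is, of the row lengths inside the
    -- Durfee square.
    have ha' : ∀ i j, i ≤ j → j < d → a j + j ≤ a i + i := by
      intro i j hij
      induction j, hij using Nat.le_induction with
      | base => intro; rfl
      | succ j hij ih =>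
        intro hj
        have h1 := ha j (j + 1) (by omega) hj
        have h2 := ih (by omega)
        omega
    have hb' : ∀ i j, i ≤ j → j < d → b j + j ≤ b i + i := by
      intro i j hij
      induction j, hij using Nat.le_induction with
      | base => intro; rfl
      | succ j hij ih =>
        intro hj
        have h1 := hb j (j + 1) (by omega) hj
        have h2 := ih (by omega)
        omega
    rintro ⟨i, j⟩ ⟨i', j'⟩ hle hmem
    obtain ⟨hi, hj⟩ : i' ≤ i ∧ j' ≤ j := hle
    simp only [Finset.coe_filter, Finset.mem_product, Finset.mem_range, Set.mem_ofPred_eq] at hmem ⊢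
    obtain ⟨⟨hbi, hbj⟩, hd, hA, hL⟩ := hmem
    have hmin : min i' j' ≤ min i j := min_le_min hi hj
    have h1 := ha' _ _ hmin hd
    have h2 := hb' _ _ hmin hd
    refine ⟨⟨by omega, by omega⟩, by omega, ?_, ?_⟩
    all_goals
      rcases le_total i j with h | h <;> rcases le_total i' j' with h' | h' <;>
        simp only [h, h', min_eq_left, min_eq_right] at hA hL h1 h2 hmin ⊢ <;> omega

section frobenius

variable {d : ℕ} {a b : ℕ → ℕ} (ha : ∀ i j, i < j → j < d → a j < a i)
    (hb : ∀ i j, i < j → j < d → b j < b i)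

theorem mem_frobenius (i j : ℕ) : (i, j) ∈ frobenius d a b ha hb ↔
    min i j < d ∧ j ≤ i + a (min i j) ∧ i ≤ j + b (min i j) := by
  rw [← mem_cells]
  simp only [frobenius, Finset.mem_filter, Finset.mem_product, Finset.mem_range,
    and_iff_right_iff_imp]
  rintro ⟨hd, h1, h2⟩
  have ha0 : a (min i j) ≤ a 0 := by
    rcases (min i j).eq_zero_or_pos with h | h
    · rw [h]
    · exact (ha _ _ h hd).le
  have hb0 : b (min i j) ≤ b 0 := by
    rcases (min i j).eq_zero_or_pos with h | h
    · rw [h]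
    · exact (hb _ _ h hd).le
  omega

theorem durfee_frobenius : (frobenius d a b ha hb).durfee = d :=
  durfee_eq_of_forall _ fun i => by simp [mem_frobenius]

theorem arm_frobenius {i : ℕ} (hi : i < d) : (frobenius d a b ha hb).arm i = a i := by
  refine arm_eq_of_forall (by rwa [durfee_frobenius]) fun j hj => ?_
  rw [mem_frobenius, min_eq_left hj]
  omega

theorem leg_frobenius {i : ℕ} (hi : i < d) : (frobenius d a b ha hb).leg i = b i := by
  refine leg_eq_of_forall (by rwa [durfee_frobenius]) fun j hj => ?_
  rw [mem_frobenius, min_eq_right hj]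
  omega

end frobenius

/-- The set of the leg lengths in the Frobenius notation. -/
def legs (μ : YoungDiagram) : Finset ℕ := (Finset.range μ.durfee).image μ.leg

theorem mem_legs {c : ℕ} : c ∈ μ.legs ↔ ∃ i < μ.durfee, μ.leg i = c := by
  simp [legs]

theorem leg_injOn : Set.InjOn μ.leg (Finset.range μ.durfee) := by
  intro i hi j hj h
  simp only [Finset.coe_range, Set.mem_Iio] at hi hj
  rcases lt_trichotomy i j with hlt | rfl | hlt
  · have := leg_lt_leg hlt hj; omega
  · rfl
  · have := leg_lt_leg hlt hi; omega

theorem card_legs : μ.legs.card = μ.durfee := by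
  rw [legs, Finset.card_image_of_injOn leg_injOn, Finset.card_range]

/-- For a nonempty diagram the longest leg is one less than the number of rows. -/
theorem legs_subset_range_iff {n : ℕ} : μ.legs ⊆ Finset.range n ↔ μ.rowLen n = 0 := by
  constructor
  · intro h
    by_contra h0
    have hm : (n, 0) ∈ μ := mem_iff_lt_rowLen.2 (Nat.pos_of_ne_zero h0)
    obtain ⟨h1, h2⟩ := (mem_iff_le_leg (Nat.zero_le n)).1 hm
    have := Finset.mem_range.1 (h (mem_legs.2 ⟨0, h1, rfl⟩))
    omega
  · intro h0 c hc
    obtain ⟨i, hi, rfl⟩ := mem_legs.1 hc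
    have hm : (i + μ.leg i, i) ∈ μ := (mem_iff_le_leg (by omega)).2 ⟨hi, le_rfl⟩
    have hm' : (μ.leg i, 0) ∈ μ := μ.up_left_mem (by omega) (Nat.zero_le _) hm
    by_contra hlt
    have h1 := mem_iff_lt_rowLen.1 hm'
    have h2 := μ.rowLen_anti n (μ.leg i) (by simpa using hlt)
    omega

end YoungDiagram

/-- The `i`-th largest element of a finite set. -/
def Finset.nthLargest (s : Finset ℕ) (i : ℕ) : ℕ :=
  if h : i < s.card then s.orderEmbOfFin rfl (Fin.rev ⟨i, h⟩) else 0

namespace Finset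

theorem nthLargest_lt (s : Finset ℕ) (i j : ℕ) (hij : i < j) (hj : j < s.card) :
    s.nthLargest j < s.nthLargest i := by
  rw [nthLargest, nthLargest, dif_pos hj, dif_pos (hij.trans hj)]
  exact (s.orderEmbOfFin rfl).strictMono (Fin.rev_lt_rev.2 hij)

theorem nthLargest_mem (s : Finset ℕ) {i : ℕ} (hi : i < s.card) : s.nthLargest i ∈ s := by
  rw [nthLargest, dif_pos hi]
  exact s.orderEmbOfFin_mem rfl _

theorem exists_nthLargest_eq (s : Finset ℕ) {c : ℕ} (hc : c ∈ s) :
    ∃ i < s.card, s.nthLargest i = c := by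
  rw [← Finset.mem_coe, ← s.range_orderEmbOfFin rfl] at hc
  obtain ⟨i, rfl⟩ := hc
  refine ⟨i.rev, i.rev.2, ?_⟩
  rw [nthLargest, dif_pos i.rev.2]
  exact congrArg _ (Fin.rev_rev i)

end Finset

namespace YoungDiagram

variable {μ ν : YoungDiagram}

/-- Legs strictly decrease, so read backwards they are the unique increasing enumeration of their
set. Hence the set alone recovers the sequence. -/
theorem leg_eq_nthLargest {i : ℕ} (hi : i < μ.durfee) : μ.leg i = μ.legs.nthLargest i := by
  have hi' : i < μ.legs.card := by rwa [card_legs]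
  have h : ∀ j : Fin μ.legs.card, (j.rev : ℕ) < μ.durfee := fun j =>
    j.rev.2.trans_eq card_legs
  have key := μ.legs.orderEmbOfFin_unique rfl (f := fun j => μ.leg j.rev)
    (fun j => mem_legs.2 ⟨_, h j, rfl⟩) (fun j k hjk => leg_lt_leg (Fin.rev_lt_rev.2 hjk) (h j))
  rw [Finset.nthLargest, dif_pos hi', ← key]
  simp

theorem IsAsymmetric.eq_of_legs_eq {k : ℤ} (hμ : μ.IsAsymmetric k) (hν : ν.IsAsymmetric k)
    (h : μ.legs = ν.legs) : μ = ν := by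
  have hd : μ.durfee = ν.durfee := by rw [← card_legs, h, card_legs]
  have hl : ∀ i < μ.durfee, μ.leg i = ν.leg i := fun i hi => by
    rw [leg_eq_nthLargest hi, h, ← leg_eq_nthLargest (hd ▸ hi)]
  refine ext_frobenius hd (fun i hi => ?_) hl
  have h1 := hμ i hi
  have h2 := hν i (hd ▸ hi)
  have h3 := hl i hi
  omega

theorem IsAsymmetric.le_of_mem_legs {k : ℤ} (hμ : μ.IsAsymmetric k) {c : ℕ} (hc : c ∈ μ.legs) :
    k ≤ c := by
  obtain ⟨i, hi, rfl⟩ := mem_legs.1 hc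
  have := hμ i hi
  omega

theorem exists_isAsymmetric_legs_eq (k : ℤ) (s : Finset ℕ) (hs : ∀ c ∈ s, k ≤ c) :
    ∃ μ : YoungDiagram, μ.IsAsymmetric k ∧ μ.legs = s := by
  have ha : ∀ i j, i < j → j < s.card →
      ((s.nthLargest j : ℤ) - k).toNat < ((s.nthLargest i : ℤ) - k).toNat := by
    intro i j hij hj
    have h1 := s.nthLargest_lt i j hij hj
    have h2 := hs _ (s.nthLargest_mem hj)
    omega
  refine ⟨frobenius s.card (fun i => ((s.nthLargest i : ℤ) - k).toNat) s.nthLargest ha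
    s.nthLargest_lt, ?_, ?_⟩
  · intro i hi
    rw [durfee_frobenius] at hi
    rw [arm_frobenius _ _ hi, leg_frobenius _ _ hi]
    have := hs _ (s.nthLargest_mem hi)
    omega
  · ext c
    rw [mem_legs, durfee_frobenius]
    constructor
    · rintro ⟨i, hi, rfl⟩
      rw [leg_frobenius _ _ hi]
      exact s.nthLargest_mem hi
    · intro hc
      obtain ⟨i, hi, rfl⟩ := s.exists_nthLargest_eq hc
      exact ⟨i, hi, leg_frobenius _ _ hi⟩

/-- The leg lengths classify the `k`-asymmetric diagrams with at most `n` rows. -/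
theorem bijOn_legs (k : ℤ) (n : ℕ) :
    Set.BijOn legs {μ | μ.IsAsymmetric k ∧ μ.rowLen n = 0} (Finset.Ico k.toNat n).powerset := by
  refine ⟨fun μ hμ => ?_, fun μ hμ ν hν h => hμ.1.eq_of_legs_eq hν.1 h, fun s hs => ?_⟩
  · refine Finset.mem_coe.2 (Finset.mem_powerset.2 fun c hc => Finset.mem_Ico.2 ⟨?_, ?_⟩)
    · have := hμ.1.le_of_mem_legs hc
      omega
    · exact Finset.mem_range.1 (legs_subset_range_iff.2 hμ.2 hc)
  · have hs' := Finset.mem_powerset.1 (Finset.mem_coe.1 hs)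
    obtain ⟨μ, hμ, rfl⟩ := exists_isAsymmetric_legs_eq k s fun c hc => by
      have := (Finset.mem_Ico.1 (hs' hc)).1
      omega
    refine ⟨μ, ⟨hμ, legs_subset_range_iff.1 fun c hc => ?_⟩, rfl⟩
    exact Finset.mem_range.2 (Finset.mem_Ico.1 (hs' hc)).2

/-! ### Sums over asymmetric diagrams as determinants -/

theorem schurPoly_eq_zero {R : Type*} [CommRing R] {n : ℕ} (h : μ.rowLen n ≠ 0) :
    schurPoly R n μ = 0 := by
  have : IsEmpty (BoundedSSYT μ n) := by
    refine ⟨fun T => ?_⟩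
    have hm : (n, 0) ∈ μ := mem_iff_lt_rowLen.2 (Nat.pos_of_ne_zero h)
    have key : ∀ i, i ≤ n → i ≤ T.1 i 0 := by
      intro i
      induction i with
      | zero => intro; omega
      | succ i ih =>
        intro hi
        have h1 := ih (by omega)
        have h2 := T.1.col_strict (Nat.lt_add_one i) (μ.up_left_mem hi le_rfl hm)
        omega
    have h1 := key n le_rfl
    have h2 := T.2 _ ((mem_cells _).2 hm)
    simp only at h2
    omega
  rw [schurPoly, Finset.univ_eq_empty, Finset.sum_empty]

-- The exponent in column `j` is `n + arm j` for `j` below the Durfee size and `n - 1 - (j - rowLen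
-- j)` otherwise. The legs and the numbers `j - rowLen j` together exhaust `0, …, n - 1`, so the
-- columns can be relabelled by these values. The function `f` recovers an arm from its leg.
open Matrix in
theorem det_rowLen_eq {R : Type*} [CommRing R] (x : ℕ → R) {n : ℕ} (h0 : μ.rowLen n = 0)
    (f : ℕ → ℕ) (hf : ∀ i < μ.durfee, μ.arm i = f (μ.leg i)) :
    det (of fun i j : Fin n => x i ^ (μ.rowLen j + (n - 1 - j))) =
      (∏ c ∈ μ.legs, (-1) ^ c) *
        det (of fun i c : Fin n => x i ^ (if (c : ℕ) ∈ μ.legs then n + f c else n - 1 - c)) := by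
  have hleg : ∀ i < μ.durfee, μ.leg i < n := fun i hi =>
    Finset.mem_range.1 (legs_subset_range_iff.2 h0 (mem_legs.2 ⟨i, hi, rfl⟩))
  let g : Fin n → Fin n := fun i => ⟨if (i : ℕ) < μ.durfee then μ.leg i else i - μ.rowLen i, by
    split_ifs with h
    · exact hleg i h
    · have := i.2
      omega⟩
  have hg1 : ∀ i : Fin n, (i : ℕ) < μ.durfee → (g i : ℕ) = μ.leg i := fun i h => if_pos h
  have hg2 : ∀ i : Fin n, ¬ (i : ℕ) < μ.durfee → (g i : ℕ) = i - μ.rowLen i := fun i h => if_neg h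
  -- Equality would mean `colLen i + rowLen j = i + j + 1`. But the sum is at least `i + j + 2` if
  -- `(j, i)` is a cell and at most `i + j` if not.
  have hdisj : ∀ i j, i < μ.durfee → ¬ j < μ.durfee → μ.leg i ≠ j - μ.rowLen j := by
    intro i j hi hj
    have h1 := rowLen_le_of_durfee_le (not_lt.1 hj)
    have h2 := lt_colLen_of_lt_durfee hi
    have h3 : i < μ.rowLen j ↔ j < μ.colLen i := mem_iff_lt_rowLen.symm.trans mem_iff_lt_colLen
    rw [leg]
    omega
  have hinj : Function.Injective g := by
    intro i j hij
    have hij' : (g i : ℕ) = g j := congrArg Fin.val hij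
    by_cases hi : (i : ℕ) < μ.durfee <;> by_cases hj : (j : ℕ) < μ.durfee
    · rw [hg1 i hi, hg1 j hj] at hij'
      exact Fin.ext (leg_injOn (by simpa using hi) (by simpa using hj) hij')
    · rw [hg1 i hi, hg2 j hj] at hij'
      exact absurd hij' (hdisj _ _ hi hj)
    · rw [hg2 i hi, hg1 j hj] at hij'
      exact absurd hij'.symm (hdisj _ _ hj hi)
    · rw [hg2 i hi, hg2 j hj] at hij'
      have h1 := rowLen_le_of_durfee_le (not_lt.1 hi)
      have h2 := rowLen_le_of_durfee_le (not_lt.1 hj)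
      rcases le_total (i : ℕ) j with h | h
      · have := μ.rowLen_anti _ _ h
        exact Fin.ext (by omega)
      · have := μ.rowLen_anti _ _ h
        exact Fin.ext (by omega)
  have hmem : ∀ i : Fin n, (g i : ℕ) ∈ μ.legs ↔ (i : ℕ) < μ.durfee := by
    intro i
    by_cases hi : (i : ℕ) < μ.durfee
    · simp only [hi, iff_true]
      exact mem_legs.2 ⟨i, hi, (hg1 i hi).symm⟩
    · simp only [hi, iff_false]
      intro hc
      obtain ⟨j, hj, hj'⟩ := mem_legs.1 hc
      exact hdisj _ _ hj hi (by rw [hj', hg2 i hi])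
  let σ : Equiv.Perm (Fin n) := Equiv.ofBijective g (Finite.injective_iff_bijective.1 hinj)
  have hσ : ∀ i, σ i = g i := fun i => rfl
  have hsign : ((Equiv.Perm.sign σ : ℤ) : R) = ∏ c ∈ μ.legs, (-1) ^ c := by
    -- Legs occupy the first positions in decreasing order, the other values follow in increasing
    -- order. So a leg `c` is inverted with all `c` smaller values and a non-leg with none of them.
    have hlt : ∀ i j : Fin n, i < j → (σ⁻¹ i < σ⁻¹ j ↔ (j : ℕ) ∉ μ.legs) := by
      intro i j hij
      obtain ⟨p, rfl⟩ := σ.surjective i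
      obtain ⟨q, rfl⟩ := σ.surjective j
      have hinv : ∀ p, σ⁻¹ (σ p) = p := σ.symm_apply_apply
      rw [hinv, hinv, hσ, hmem, Fin.lt_def]
      have hij' : (g p : ℕ) < g q := hij
      by_cases hp : (p : ℕ) < μ.durfee <;> by_cases hq : (q : ℕ) < μ.durfee
      · rw [hg1 p hp, hg1 q hq] at hij'
        simp only [hq, not_true, iff_false, not_lt]
        by_contra hlt
        have := leg_lt_leg (not_le.1 hlt) hq
        omega
      · omega
      · omega
      · rw [hg2 p hp, hg2 q hq] at hij'
        simp only [hq, not_false_iff, iff_true]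
        by_contra hlt
        have := μ.rowLen_anti _ _ (not_lt.1 hlt)
        omega
    have h1 : (Equiv.Perm.sign σ : ℤ) = ∏ j : Fin n, if (j : ℕ) ∈ μ.legs then (-1) ^ (j : ℕ) else 1 := by
      rw [← Equiv.Perm.sign_inv, Equiv.Perm.sign_eq_prod_prod_Iio, Units.coe_prod]
      refine Finset.prod_congr rfl fun j _ => ?_
      rw [Units.coe_prod]
      split_ifs with hj
      · rw [Finset.prod_congr rfl (g := fun _ => (-1 : ℤ)), Finset.prod_const, Fin.card_Iio]
        intro i hi
        rw [if_neg]
        · rfl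
        · rw [hlt i j (Finset.mem_Iio.1 hi)]
          simpa using hj
      · refine Finset.prod_eq_one fun i hi => ?_
        rw [if_pos ((hlt i j (Finset.mem_Iio.1 hi)).2 hj)]
        rfl
    rw [h1]
    push_cast
    rw [Fin.prod_univ_eq_prod_range (fun j => (if j ∈ μ.legs then (-1) ^ j else 1 : R)),
      Finset.prod_ite_mem, Finset.inter_eq_right.2 (legs_subset_range_iff.2 h0)]
  rw [← hsign, ← det_permute']
  congr 1
  ext i j
  simp only [of_apply, submatrix_apply, id_eq, hσ, hmem]
  congr 1
  have hj := j.2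
  split_ifs with h
  · have h1 := lt_rowLen_of_lt_durfee h
    rw [hg1 j h, ← hf j h, arm]
    omega
  · have h1 := rowLen_le_of_durfee_le (not_lt.1 h)
    rw [hg2 j h]
    omega

end YoungDiagram

-- Here `s` is the set of columns from which `B` is chosen; it will be the set of legs.
open Matrix in
theorem det_add_columns {R : Type*} [CommRing R] {n : ℕ} (t : Finset (Fin n))
    (A B : Fin n → Fin n → R) :
    det (of fun i c => A i c + if c ∈ t then B i c else 0) =
      ∑ s ∈ t.powerset, det (of fun i c => if c ∈ s then B i c else A i c) := by
  have h := (detRowAlternating (n := Fin n) (R := R)).toMultilinearMap.map_piecewise_add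
    (fun c i => B i c) (fun c i => A i c) t
  rw [← det_transpose]
  refine Eq.trans ?_ (h.trans ?_)
  · change det _ = det _
    congr 1
    ext c i
    by_cases hc : c ∈ t <;> simp [hc, add_comm]
  · refine Finset.sum_congr rfl fun s _ => ?_
    rw [← det_transpose]
    change det _ = det _
    congr 1
    ext c i
    by_cases hc : c ∈ s <;> simp [hc]

namespace YoungDiagram

/-- The `k`-asymmetric diagram with leg lengths `s`. -/
noncomputable def asymmetricOfLegs (k : ℤ) (s : Finset ℕ) : YoungDiagram :=
  Function.invFunOn legs {μ | μ.IsAsymmetric k} s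

theorem isAsymmetric_asymmetricOfLegs {k : ℤ} {s : Finset ℕ} (hs : ∀ c ∈ s, k ≤ c) :
    (asymmetricOfLegs k s).IsAsymmetric k :=
  Function.invFunOn_mem (exists_isAsymmetric_legs_eq k s hs)

theorem legs_asymmetricOfLegs {k : ℤ} {s : Finset ℕ} (hs : ∀ c ∈ s, k ≤ c) :
    (asymmetricOfLegs k s).legs = s :=
  Function.invFunOn_eq (s := {μ : YoungDiagram | μ.IsAsymmetric k})
    (exists_isAsymmetric_legs_eq k s hs)

theorem IsAsymmetric.asymmetricOfLegs_legs {k : ℤ} {μ : YoungDiagram} (h : μ.IsAsymmetric k) :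
    asymmetricOfLegs k μ.legs = μ :=
  (isAsymmetric_asymmetricOfLegs fun _ hc => h.le_of_mem_legs hc).eq_of_legs_eq h
    (legs_asymmetricOfLegs fun _ hc => h.le_of_mem_legs hc)

/-- The support of `F` consists of diagrams with at most `n` rows, which `bijOn_legs` parametrizes
by finitely many leg sets. -/
theorem finsum_isAsymmetric {A : Type*} [AddCommMonoid A] (k : ℤ) (n : ℕ) (F : YoungDiagram → A)
    (hF : ∀ μ, μ.rowLen n ≠ 0 → F μ = 0) :
    ∑ᶠ μ ∈ {μ : YoungDiagram | μ.IsAsymmetric k}, F μ =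
      ∑ s ∈ (Finset.Ico k.toNat n).powerset, F (asymmetricOfLegs k s) := by
  rw [finsum_mem_inter_support_eq F {μ : YoungDiagram | μ.IsAsymmetric k}
    {μ | μ.IsAsymmetric k ∧ μ.rowLen n = 0},
    finsum_mem_eq_of_bijOn legs (bijOn_legs k n) (g := fun s => F (asymmetricOfLegs k s)),
    finsum_mem_coe_finset]
  · intro μ hμ
    rw [hμ.1.asymmetricOfLegs_legs]
  · ext μ
    simp only [Set.mem_inter_iff, Set.mem_ofPred_eq, Function.mem_support]
    refine ⟨fun h => ⟨⟨h.1, ?_⟩, h.2⟩, fun h => ⟨h.1.1, h.2⟩⟩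
    by_contra h0
    exact h.2 (hF μ h0)

theorem finite_isAsymmetric_schurPoly_ne_zero (R : Type*) [CommRing R] (k : ℤ) (n : ℕ) :
    {μ : YoungDiagram | μ.IsAsymmetric k ∧ schurPoly R n μ ≠ 0}.Finite := by
  have h : {μ : YoungDiagram | μ.IsAsymmetric k ∧ μ.rowLen n = 0}.Finite :=
    Set.Finite.of_finite_image
      ((bijOn_legs k n).image_eq ▸ Finset.finite_toSet _) (bijOn_legs k n).injOn
  refine h.subset fun μ hμ => ⟨hμ.1, ?_⟩
  by_contra h0
  exact hμ.2 (schurPoly_eq_zero h0)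

-- Choosing the second summand in column `c` of the right-hand determinant means that `c` is a leg;
-- the sign `(-1)^c` compensates for the reordering in `det_rowLen_eq`.
open Matrix in
theorem det_mul_sum_schurEval {R : Type*} [CommRing R] (x : ℕ → R) (k : ℤ) (n : ℕ) (η : ℕ → R) :
    det (of fun i j : Fin n => x i ^ (n - 1 - (j : ℕ))) *
        ∑ s ∈ (Finset.Ico k.toNat n).powerset,
          (∏ c ∈ s, η c) * schurEval x n (asymmetricOfLegs k s) =
      det (of fun i c : Fin n => x i ^ (n - 1 - (c : ℕ)) +
        if k.toNat ≤ c then η c * (-1) ^ (c : ℕ) * x i ^ (n + ((c : ℤ) - k).toNat) else 0) := by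
  have hcols := det_add_columns (Finset.univ.filter fun c : Fin n => k.toNat ≤ c)
    (fun i c => x i ^ (n - 1 - (c : ℕ)))
    (fun i c => η c * (-1) ^ (c : ℕ) * x i ^ (n + ((c : ℤ) - k).toNat))
  simp only [Finset.mem_filter, Finset.mem_univ, true_and] at hcols
  have hico : Finset.Ico k.toNat n =
      (Finset.univ.filter fun c : Fin n => k.toNat ≤ c).image Fin.val := by
    ext c
    simp only [Finset.mem_Ico, Finset.mem_image, Finset.mem_filter, Finset.mem_univ, true_and]
    exact ⟨fun h => ⟨⟨c, h.2⟩, h.1, rfl⟩, fun ⟨a, h, ha⟩ => ha ▸ ⟨h, a.2⟩⟩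
  rw [hcols, Finset.mul_sum, hico, Finset.powerset_image,
    Finset.sum_image (Finset.image_injective Fin.val_injective).injOn]
  refine Finset.sum_congr rfl fun s hs => ?_
  have hs1 : ∀ c ∈ s.image Fin.val, k ≤ (c : ℕ) := by
    intro c hc
    obtain ⟨a, ha, rfl⟩ := Finset.mem_image.1 hc
    have := (Finset.mem_filter.1 (Finset.mem_powerset.1 hs ha)).2
    omega
  have hlegs := legs_asymmetricOfLegs hs1
  have hasym := isAsymmetric_asymmetricOfLegs hs1
  have h0 : (asymmetricOfLegs k (s.image Fin.val)).rowLen n = 0 := by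
    rw [← legs_subset_range_iff, hlegs]
    intro c hc
    obtain ⟨a, _, rfl⟩ := Finset.mem_image.1 hc
    exact Finset.mem_range.2 a.2
  rw [mul_left_comm, det_mul_schurEval x n _ h0, det_rowLen_eq x h0 (fun c => ((c : ℤ) - k).toNat)
    (fun i hi => by have := hasym i hi; omega), hlegs, ← mul_assoc, ← Finset.prod_mul_distrib,
    Finset.prod_image Fin.val_injective.injOn]
  have hmem : ∀ c : Fin n, (c : ℕ) ∈ s.image Fin.val ↔ c ∈ s := fun c =>
    ⟨fun h => by
      obtain ⟨a, ha, hac⟩ := Finset.mem_image.1 h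
      rwa [← Fin.ext hac], fun h => Finset.mem_image_of_mem _ h⟩
  simp only [hmem]
  have hrow := det_mul_row (fun c : Fin n => if c ∈ s then η c * (-1) ^ (c : ℕ) else 1)
    (of fun i c : Fin n => x i ^ (if c ∈ s then n + ((c : ℤ) - k).toNat else n - 1 - c))
  rw [Finset.prod_ite_mem, Finset.univ_inter] at hrow
  rw [← hrow]
  congr 1
  ext i c
  by_cases hc : c ∈ s <;> simp [hc]

/-- A sum of Schur polynomials over asymmetric diagrams is the quotient of two determinants. -/
theorem sum_schurPoly_eq {n : ℕ} (k : ℤ) (η : ℕ → ℤ) (P : MvPolynomial (Fin n) ℚ)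
    (hP : ∀ (K : Type) [Field K] (φ : MvPolynomial (Fin n) ℚ →+* K) (x : Fin n → K),
      (∀ i, x i = φ (MvPolynomial.X i)) → (∀ i, x i ≠ 0) →
      Matrix.det (Matrix.of fun i c : Fin n => x i ^ (n - 1 - (c : ℕ)) +
        if k.toNat ≤ c then η c * (-1) ^ (c : ℕ) * x i ^ (n + ((c : ℤ) - k).toNat) else 0) =
      Matrix.det (Matrix.of fun i j : Fin n => x i ^ (n - 1 - (j : ℕ))) * φ P) :
    ∑ s ∈ (Finset.Ico k.toNat n).powerset,
      ((∏ c ∈ s, η c : ℤ) : MvPolynomial (Fin n) ℚ) * schurPoly ℚ n (asymmetricOfLegs k s) = P := by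
  -- In the fraction field the variables are invertible, as `hP` requires, and the Vandermonde
  -- determinant can be cancelled.
  set φ : MvPolynomial (Fin n) ℚ →+* FractionRing (MvPolynomial (Fin n) ℚ) := algebraMap _ _ with hφ
  have hinj : Function.Injective φ := IsFractionRing.injective _ _
  let x : ℕ → FractionRing (MvPolynomial (Fin n) ℚ) := fun i =>
    if h : i < n then φ (MvPolynomial.X ⟨i, h⟩) else 0
  have hx : ∀ i : Fin n, x i = φ (MvPolynomial.X i) := fun i => dif_pos i.2
  have hx0 : ∀ i : Fin n, x i ≠ 0 := fun i => by
    rw [hx, map_ne_zero_iff φ hinj]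
    exact MvPolynomial.X_ne_zero i
  have hdet : Matrix.det (Matrix.of fun i j : Fin n => x i ^ (n - 1 - (j : ℕ))) ≠ 0 := by
    rw [det_pow_rev (fun i : Fin n => x i)]
    refine Finset.prod_ne_zero_iff.2 fun i _ => Finset.prod_ne_zero_iff.2 fun j hj => ?_
    rw [sub_ne_zero, hx, hx]
    intro h
    exact (Finset.mem_Ioi.1 hj).ne (MvPolynomial.X_injective (hinj h))
  apply hinj
  apply mul_left_cancel₀ hdet
  rw [← hP _ φ (fun i => x i) hx hx0, ← det_mul_sum_schurEval x k n (fun c => (η c : _))]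
  congr 1
  rw [map_sum]
  refine Finset.sum_congr rfl fun s _ => ?_
  rw [map_mul, map_intCast, map_schurPoly n _ φ x hx]
  push_cast
  rfl

/-! ### The three product formulas -/

theorem pow_sub_eq_mul_inv_pow {K : Type*} [Field K] {x : K} (hx : x ≠ 0) {n c : ℕ} (hc : c < n) :
    x ^ (n - 1 - c) = x ^ (n - 1) * x⁻¹ ^ c := by
  rw [pow_sub₀ x hx (by omega), inv_pow]

theorem sum_schurPoly_one (n : ℕ) :
    ∑ s ∈ (Finset.Ico 1 n).powerset, schurPoly ℚ n (asymmetricOfLegs 1 s) =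
      ∏ i : Fin n, ∏ j ∈ Finset.Ioi i, (1 + MvPolynomial.X i * MvPolynomial.X j) := by
  have := sum_schurPoly_eq (n := n) 1 (fun _ => 1)
    (∏ i : Fin n, ∏ j ∈ Finset.Ioi i, (1 + MvPolynomial.X i * MvPolynomial.X j)) ?_
  · simpa using this
  intro K _ φ x hx hx0
  -- Column `0` cannot be a leg, so it is `1` rather than `x^0 + x^0 = 2`. This is why the first
  -- recurrence coefficient is `2` and the later ones are `1`.
  have key := det_weyl x (fun i => (x i)⁻¹ - x i) (fun _ => 1) 1
    (fun i j => by field_simp [hx0 i, hx0 j]; ring)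
    (fun c i => (x i)⁻¹ ^ c + if c = 0 then 0 else (-1) ^ c * x i ^ c) 0
    (fun c => if c = 0 then 2 else 1) (fun i => by simp) (fun i => by simp; ring)
    (fun c i => by
      have h := mul_inv_cancel₀ (hx0 i)
      rcases c with _ | c
      · simp
        linear_combination 2 * h
      · rw [if_neg (by omega), if_neg (by omega), if_neg (by omega), if_neg (by omega)]
        generalize (x i)⁻¹ = y at h ⊢
        linear_combination (y ^ (c + 1) + (-1) ^ (c + 1) * x i ^ (c + 1)) * h)
  simp only [map_prod, map_add, map_one, map_mul, ← hx]
  simp only [one_mul, Finset.prod_const_one] at key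
  rw [← key]
  congr 1
  ext i c
  simp only [Matrix.of_apply, mul_add, ← pow_sub_eq_mul_inv_pow (hx0 i) c.2]
  congr 1
  rcases Nat.eq_zero_or_pos (c : ℕ) with h | h
  · simp [h]
  · have hc := c.2
    rw [if_pos (show (1 : ℤ).toNat ≤ (c : ℕ) from h), if_neg (by omega),
      show n + ((c : ℤ) - 1).toNat = n - 1 + c by omega, pow_add]
    push_cast
    ring

theorem sum_schurPoly_zero (n : ℕ) :
    ∑ s ∈ (Finset.range n).powerset,
        ((∏ c ∈ s, (-1) ^ (c + 1) : ℤ) : MvPolynomial (Fin n) ℚ) *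
          schurPoly ℚ n (asymmetricOfLegs 0 s) =
      (∏ i : Fin n, (1 - MvPolynomial.X i)) *
        ∏ i : Fin n, ∏ j ∈ Finset.Ioi i, (1 - MvPolynomial.X i * MvPolynomial.X j) := by
  have := sum_schurPoly_eq (n := n) 0 (fun c => (-1) ^ (c + 1))
    ((∏ i : Fin n, (1 - MvPolynomial.X i)) *
      ∏ i : Fin n, ∏ j ∈ Finset.Ioi i, (1 - MvPolynomial.X i * MvPolynomial.X j)) ?_
  · simpa using this
  intro K _ φ x hx hx0
  -- The weight `(-1)^(c+1)` times the reordering sign `(-1)^c` is always `-1`, so the columns are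
  -- `x^(-c) - x^(c+1)`.
  have key := det_weyl x (fun i => (x i)⁻¹ + x i) (fun i => 1 - x i) (-1)
    (fun i j => by field_simp [hx0 i, hx0 j]; ring)
    (fun c i => (x i)⁻¹ ^ c - x i ^ (c + 1)) 1
    (fun _ => -1) (fun i => by simp)
    (fun i => by
      have h := mul_inv_cancel₀ (hx0 i)
      simp
      linear_combination h)
    (fun c i => by
      have h := mul_inv_cancel₀ (hx0 i)
      generalize (x i)⁻¹ = y at h ⊢
      linear_combination (x i ^ (c + 1) - y ^ c) * h)
  simp only [map_prod, map_sub, map_one, map_mul, ← hx]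
  simp only [neg_mul, one_mul, ← sub_eq_add_neg] at key
  rw [← key]
  congr 1
  ext i c
  have hc := c.2
  simp only [Matrix.of_apply, mul_sub, ← pow_sub_eq_mul_inv_pow (hx0 i) c.2]
  rw [if_pos (by simp), sub_eq_add_neg (x i ^ (n - 1 - (c : ℕ)))]
  congr 1
  rw [show n + ((c : ℤ) - 0).toNat = n - 1 + (c + 1) by omega, pow_add (x i) (n - 1)]
  push_cast
  rw [← pow_add, (show Odd ((c : ℕ) + 1 + c) from ⟨c, by ring⟩).neg_one_pow]
  ring

theorem sum_schurPoly_neg_one (n : ℕ) :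
    ∑ s ∈ (Finset.range n).powerset, schurPoly ℚ n (asymmetricOfLegs (-1) s) =
      (∏ i : Fin n, (1 + MvPolynomial.X i ^ 2)) *
        ∏ i : Fin n, ∏ j ∈ Finset.Ioi i, (1 + MvPolynomial.X i * MvPolynomial.X j) := by
  have := sum_schurPoly_eq (n := n) (-1) (fun _ => 1)
    ((∏ i : Fin n, (1 + MvPolynomial.X i ^ 2)) *
      ∏ i : Fin n, ∏ j ∈ Finset.Ioi i, (1 + MvPolynomial.X i * MvPolynomial.X j)) ?_
  · simpa using this
  intro K _ φ x hx hx0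
  -- The columns are `x^(-c) + (-1)^c x^(c+2)`; column `0` supplies the factor `1 + x^2`.
  have key := det_weyl x (fun i => (x i)⁻¹ - x i) (fun i => 1 + x i ^ 2) 1
    (fun i j => by field_simp [hx0 i, hx0 j]; ring)
    (fun c i => (x i)⁻¹ ^ c + (-1) ^ c * x i ^ (c + 2)) 0
    (fun _ => 1) (fun i => by simp)
    (fun i => by
      have h := mul_inv_cancel₀ (hx0 i)
      simp
      linear_combination (- x i) * h)
    (fun c i => by
      have h := mul_inv_cancel₀ (hx0 i)
      generalize (x i)⁻¹ = y at h ⊢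
      linear_combination (y ^ c + (-1) ^ c * x i ^ (c + 2)) * h)
  simp only [map_prod, map_add, map_one, map_mul, map_pow, ← hx]
  simp only [one_mul] at key
  rw [← key]
  congr 1
  ext i c
  have hc := c.2
  simp only [Matrix.of_apply, mul_add, ← pow_sub_eq_mul_inv_pow (hx0 i) c.2]
  rw [if_pos (by simp)]
  congr 1
  rw [show n + ((c : ℤ) - -1).toNat = n - 1 + (c + 2) by omega, pow_add _ (n - 1)]
  push_cast
  ring

end YoungDiagram

/-! ### Self-conjugate diagrams and the shift of legs -/

namespace YoungDiagram

variable {μ : YoungDiagram}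

theorem card_eq_sum_arm_leg (μ : YoungDiagram) :
    μ.card = ∑ i ∈ Finset.range μ.durfee, (μ.arm i + 1) + ∑ i ∈ Finset.range μ.durfee, μ.leg i := by
  rw [YoungDiagram.card, ← Finset.card_filter_add_card_filter_not (fun c : ℕ × ℕ => c.1 ≤ c.2)]
  congr 1
  · rw [Finset.card_eq_sum_card_fiberwise (f := Prod.fst) (t := Finset.range μ.durfee)]
    · refine Finset.sum_congr rfl fun i hi => ?_
      have : {c ∈ {c ∈ μ.cells | c.1 ≤ c.2} | c.1 = i} =
          (Finset.Icc i (i + μ.arm i)).image fun j => (i, j) := by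
        ext ⟨a, j⟩
        simp only [Finset.mem_filter, mem_cells, Finset.mem_image, Finset.mem_Icc, Prod.mk.injEq]
        constructor
        · rintro ⟨⟨hm, hle⟩, rfl⟩
          exact ⟨j, ⟨hle, ((mem_iff_le_arm hle).1 hm).2⟩, rfl, rfl⟩
        · rintro ⟨t, ⟨h1, h2⟩, rfl, rfl⟩
          exact ⟨⟨(mem_iff_le_arm h1).2 ⟨Finset.mem_range.1 hi, h2⟩, h1⟩, rfl⟩
      rw [this, Finset.card_image_of_injective _ fun a b hab => (Prod.mk.inj hab).2, Nat.card_Icc]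
      omega
    · rintro ⟨i, j⟩ hij
      simp only [Finset.coe_filter, mem_cells, Set.mem_ofPred_eq] at hij
      simpa using ((mem_iff_le_arm hij.2).1 hij.1).1
  · rw [Finset.card_eq_sum_card_fiberwise (f := Prod.snd) (t := Finset.range μ.durfee)]
    · refine Finset.sum_congr rfl fun j hj => ?_
      have : {c ∈ {c ∈ μ.cells | ¬ c.1 ≤ c.2} | c.2 = j} =
          (Finset.Ioc j (j + μ.leg j)).image fun i => (i, j) := by
        ext ⟨i, a⟩
        simp only [Finset.mem_filter, mem_cells, Finset.mem_image, Finset.mem_Ioc, Prod.mk.injEq]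
        constructor
        · rintro ⟨⟨hm, hlt⟩, rfl⟩
          exact ⟨i, ⟨not_le.1 hlt, ((mem_iff_le_leg (by omega)).1 hm).2⟩, rfl, rfl⟩
        · rintro ⟨t, ⟨h1, h2⟩, rfl, rfl⟩
          exact ⟨⟨(mem_iff_le_leg h1.le).2 ⟨Finset.mem_range.1 hj, h2⟩, not_le.2 h1⟩, rfl⟩
      rw [this, Finset.card_image_of_injective _ fun a b hab => (Prod.mk.inj hab).1, Nat.card_Ioc]
      omega
    · rintro ⟨i, j⟩ hij
      simp only [Finset.coe_filter, mem_cells, Set.mem_ofPred_eq] at hij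
      simpa using ((mem_iff_le_leg (by omega)).1 hij.1).1

theorem sum_range_durfee_leg {A : Type*} [AddCommMonoid A] (F : ℕ → A) :
    ∑ i ∈ Finset.range μ.durfee, F (μ.leg i) = ∑ c ∈ μ.legs, F c := by
  rw [legs, Finset.sum_image leg_injOn]

theorem IsAsymmetric.arm_eq_leg (h : μ.IsAsymmetric 0) {i : ℕ} (hi : i < μ.durfee) :
    μ.arm i = μ.leg i := by
  have := h i hi
  omega

theorem IsAsymmetric.sum_arm_add_one (h : μ.IsAsymmetric 0) :
    ∑ i ∈ Finset.range μ.durfee, (μ.arm i + 1) = ∑ c ∈ μ.legs, (c + 1) := by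
  rw [← sum_range_durfee_leg fun c => c + 1]
  exact Finset.sum_congr rfl fun i hi => by rw [h.arm_eq_leg (Finset.mem_range.1 hi)]

/-- A hook with arm and leg `c` has `2c + 1` cells, so the division by two is exact and the result
is the exponent of `u` in the weight. -/
theorem IsAsymmetric.card_add_durfee_div_two (h : μ.IsAsymmetric 0) :
    (μ.card + μ.durfee) / 2 = ∑ c ∈ μ.legs, (c + 1) := by
  have h1 := sum_range_durfee_leg (μ := μ) fun c => c
  have h2 := Finset.sum_add_distrib (s := μ.legs) (f := fun c => c) (g := fun _ => 1)
  rw [Finset.sum_const, smul_eq_mul, mul_one, card_legs] at h2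
  rw [card_eq_sum_arm_leg, h.sum_arm_add_one, h1]
  omega

theorem IsAsymmetric.symm (h : μ.IsAsymmetric 0) (i j : ℕ) : (i, j) ∈ μ ↔ (j, i) ∈ μ := by
  have key : ∀ i j, i ≤ j → ((i, j) ∈ μ ↔ (j, i) ∈ μ) := fun i j hij => by
    rw [mem_iff_le_arm hij, mem_iff_le_leg hij]
    exact and_congr_right fun hi => by rw [h.arm_eq_leg hi]
  rcases le_total i j with hij | hij
  · exact key i j hij
  · exact (key j i hij).symm

section frobeniusShift

variable {k : ℤ} (hk : -1 ≤ k) (hμ : ∀ i, (i, i) ∈ μ → μ.arm i ≤ μ.leg i)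

theorem mem_frobeniusShift (i j : ℕ) : (i, j) ∈ μ.frobeniusShift k hk hμ ↔
    (min i j, min i j) ∈ μ ∧ (i ≤ j → j ≤ i + μ.arm i) ∧
      (j ≤ i → (i : ℤ) ≤ j + (μ.leg j + k)) := by
  rw [← mem_cells]
  simp only [frobeniusShift, Finset.mem_filter, Finset.mem_product, Finset.mem_range,
    and_iff_right_iff_imp]
  rintro ⟨hm, h1, h2⟩
  rcases le_total i j with h | h
  · rw [min_eq_left h] at hm
    have h3 := mem_iff_lt_rowLen.1 hm
    have h4 := h1 h
    have h5 := μ.rowLen_anti 0 i (Nat.zero_le _)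
    rw [arm] at h4
    omega
  · rw [min_eq_right h] at hm
    have h3 := mem_iff_lt_colLen.1 hm
    have h4 := h2 h
    have h5 := μ.colLen_anti 0 j (Nat.zero_le _)
    rw [leg] at h4
    omega

theorem lt_durfee_frobeniusShift (i : ℕ) :
    i < (μ.frobeniusShift k hk hμ).durfee ↔ i < μ.durfee ∧ 0 ≤ μ.leg i + k := by
  rw [← diag_mem_iff, mem_frobeniusShift, ← diag_mem_iff, min_self]
  refine and_congr_right fun _ => ⟨fun h => ?_, fun h => ⟨fun _ => by omega, fun _ => by omega⟩⟩
  have := h.2 le_rfl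
  omega

theorem arm_frobeniusShift {i : ℕ} (hi : i < (μ.frobeniusShift k hk hμ).durfee) :
    (μ.frobeniusShift k hk hμ).arm i = μ.arm i := by
  refine arm_eq_of_forall hi fun j hj => ?_
  obtain ⟨h1, h2⟩ := (lt_durfee_frobeniusShift hk hμ i).1 hi
  rw [mem_frobeniusShift, min_eq_left hj, diag_mem_iff]
  refine ⟨fun h => h.2.1 hj, fun h => ⟨h1, fun _ => h, fun h' => ?_⟩⟩
  obtain rfl := le_antisymm hj h'
  omega

theorem leg_frobeniusShift {j : ℕ} (hj : j < (μ.frobeniusShift k hk hμ).durfee) :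
    ((μ.frobeniusShift k hk hμ).leg j : ℤ) = μ.leg j + k := by
  obtain ⟨h1, h2⟩ := (lt_durfee_frobeniusShift hk hμ j).1 hj
  rw [leg_eq_of_forall (b := (μ.leg j + k).toNat) hj, Int.toNat_of_nonneg h2]
  intro i hi
  rw [mem_frobeniusShift, min_eq_right hi, diag_mem_iff]
  refine ⟨fun h => ?_, fun h => ⟨h1, fun h' => ?_, fun _ => by omega⟩⟩
  · have := h.2.2 hi
    omega
  · obtain rfl := le_antisymm hi h'
    omega

/-- The filter matters only for `k = -1`, where it discards the leg `0`. -/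
theorem legs_frobeniusShift : (μ.frobeniusShift k hk hμ).legs =
    (μ.legs.filter fun c : ℕ => 0 ≤ c + k).image fun c : ℕ => (c + k).toNat := by
  ext c
  simp only [mem_legs, Finset.mem_image, Finset.mem_filter]
  constructor
  · rintro ⟨i, hi, rfl⟩
    have h := leg_frobeniusShift hk hμ hi
    obtain ⟨h1, h2⟩ := (lt_durfee_frobeniusShift hk hμ i).1 hi
    exact ⟨μ.leg i, ⟨⟨i, h1, rfl⟩, h2⟩, by omega⟩
  · rintro ⟨_, ⟨⟨i, hi, rfl⟩, h2⟩, rfl⟩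
    have hi' := (lt_durfee_frobeniusShift hk hμ i).2 ⟨hi, h2⟩
    have h := leg_frobeniusShift hk hμ hi'
    exact ⟨i, hi', by omega⟩

theorem IsAsymmetric.frobeniusShift (h : μ.IsAsymmetric 0) :
    (μ.frobeniusShift k hk hμ).IsAsymmetric k := by
  intro i hi
  rw [leg_frobeniusShift hk hμ hi, arm_frobeniusShift hk hμ hi,
    h.arm_eq_leg ((lt_durfee_frobeniusShift hk hμ i).1 hi).1]

end frobeniusShift

end YoungDiagram

/-! ### Totally symmetric plane partitions with self-conjugate diagonal -/

theorem exists_forall_lt_iff_of_antitone (m : ℕ) (p : ℕ → Prop)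
    (hp : ∀ l l', l ≤ l' → p l' → p l) : ∃ N : Fin (m + 1), ∀ l, l < (N : ℕ) ↔ l < m ∧ p l := by
  classical
  have hex : ∃ l, ¬ (l < m ∧ p l) := ⟨m, by simp⟩
  refine ⟨⟨Nat.find hex, Nat.lt_succ_of_le (Nat.find_min' hex (by simp))⟩, fun l => ?_⟩
  rw [Nat.lt_find_iff]
  exact ⟨fun h => not_not.1 (h l le_rfl),
    fun h l' hl' => not_not.2 ⟨hl'.trans_lt h.1, hp _ _ hl' h.2⟩⟩

namespace TSPP

open YoungDiagram

variable {m : ℕ}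

/-- A totally symmetric plane partition with self-conjugate diagonal is determined by it. -/
theorem lt_iff_of_isAsymmetric (T : TSPP m) (h : T.diag.IsAsymmetric 0) (i j l : Fin m) :
    (l : ℕ) < T.1 i j ↔ (max (max (i : ℕ) j) l, min (min (i : ℕ) j) l) ∈ T.diag := by
  have hcyc := T.2.2.2.2
  have hsymm := T.2.2.2.1
  -- For sorted coordinates, `T i j ≤ T i i` gives one direction. Conversely, self-conjugacy turns
  -- `l < T i i` into `i < T l l`, which rotates to `l < T l i = T i l ≤ T i j`.
  have key : ∀ i j l : Fin m, i ≤ j → j ≤ l → ((l : ℕ) < T.1 i j ↔ ((l : ℕ), (i : ℕ)) ∈ T.diag) := by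
    intro i j l hij hjl
    constructor
    · intro hl
      exact (T.mem_diag _ _).2 ⟨i.2, hl.trans_le (T.2.2.1 i i j hij)⟩
    · intro hd
      obtain ⟨_, hd'⟩ := (T.mem_diag _ _).1 ((h.symm _ _).1 hd)
      have h1 : (l : ℕ) < T.1 l i := (hcyc l l i).1 hd'
      rw [hsymm] at h1
      exact h1.trans_le (T.2.2.1 i j l hjl)
  have h1 : (l : ℕ) < T.1 i j ↔ (l : ℕ) < T.1 j i := by rw [hsymm]
  have h2 : (i : ℕ) < T.1 j l ↔ (i : ℕ) < T.1 l j := by rw [hsymm]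
  have h3 : (j : ℕ) < T.1 l i ↔ (j : ℕ) < T.1 i l := by rw [hsymm]
  have h4 := hcyc i j l
  have h5 := hcyc j l i
  rcases le_total i j with hij | hij <;> rcases le_total j l with hjl | hjl <;>
    rcases le_total i l with hil | hil <;>
    simp only [Fin.le_def] at hij hjl hil
  · rw [key i j l hij hjl, show max (max (i : ℕ) j) l = l by omega,
      show min (min (i : ℕ) j) l = i by omega]
  · rw [key i j l hij hjl, show max (max (i : ℕ) j) l = l by omega,
      show min (min (i : ℕ) j) l = i by omega]
  · rw [h4, h5, h3, key i l j hil hjl, show max (max (i : ℕ) j) l = j by omega,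
      show min (min (i : ℕ) j) l = i by omega]
  · rw [h4, h5, key l i j hil hij, show max (max (i : ℕ) j) l = j by omega,
      show min (min (i : ℕ) j) l = l by omega]
  · rw [h1, key j i l hij hil, show max (max (i : ℕ) j) l = l by omega,
      show min (min (i : ℕ) j) l = j by omega]
  · rw [h4, key j l i hjl hil, show max (max (i : ℕ) j) l = i by omega,
      show min (min (i : ℕ) j) l = j by omega]
  · rw [h4, h2, key l j i hjl hij, show max (max (i : ℕ) j) l = i by omega,
      show min (min (i : ℕ) j) l = l by omega]
  · rw [h4, h2, key l j i hjl hij, show max (max (i : ℕ) j) l = i by omega,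
      show min (min (i : ℕ) j) l = l by omega]

/-- Place a cube at `(i, j, l)` when the pair of largest and smallest coordinate is a cell of `μ`.
The condition is symmetric and downward closed, and self-conjugacy of `μ` makes the diagonal equal
to `μ`. -/
theorem exists_diag_eq {μ : YoungDiagram} (h : μ.IsAsymmetric 0) (h0 : μ.rowLen m = 0) :
    ∃ T : TSPP m, T.diag = μ := by
  have hlt : ∀ i j, (i, j) ∈ μ → i < m := by
    intro i j hm
    by_contra hi
    have h1 := μ.rowLen_anti m i (not_lt.1 hi)
    have h2 := mem_iff_lt_rowLen.1 hm
    omega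
  choose T hT using fun i j : Fin m => exists_forall_lt_iff_of_antitone m
    (fun l => (max (max (i : ℕ) j) l, min (min (i : ℕ) j) l) ∈ μ)
    (fun l l' hl hl' => μ.up_left_mem (by omega) (by omega) hl')
  have hmono : ∀ i j i' j' : Fin m, i ≤ i' → j ≤ j' → T i' j' ≤ T i j := by
    intro i j i' j' hi hj
    rw [Fin.le_def] at hi hj ⊢
    by_contra hlt
    obtain ⟨h1, h2⟩ := (hT i' j' _).1 (not_le.1 hlt)
    exact lt_irrefl _ ((hT i j _).2 ⟨h1, μ.up_left_mem (by omega) (by omega) h2⟩)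
  have hcongr : ∀ {a b a' b' : ℕ}, a = a' → b = b' → ((a, b) ∈ μ ↔ (a', b') ∈ μ) := by
    rintro a b _ _ rfl rfl
    rfl
  have hT' : IsTSPP m T := by
    refine ⟨fun i i' j hi => hmono _ _ _ _ hi le_rfl, fun i j j' hj => hmono _ _ _ _ le_rfl hj,
      fun i j => ?_, fun i j l => ?_⟩
    · refine Fin.ext (eq_of_forall_lt_iff fun l => ?_)
      rw [hT, hT]
      exact and_congr_right fun _ => hcongr (by omega) (by omega)
    · rw [hT, hT]
      exact and_congr (by simp) (hcongr (by omega) (by omega))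
  let T' : TSPP m := ⟨T, hT'⟩
  refine ⟨T', ?_⟩
  ext ⟨i, j⟩
  rw [mem_cells, mem_cells, mem_diag]
  change (∃ h : j < m, i < (T ⟨j, h⟩ ⟨j, h⟩ : ℕ)) ↔ _
  constructor
  · rintro ⟨hj, hi⟩
    have h1 := ((hT ⟨j, hj⟩ ⟨j, hj⟩ i).1 hi).2
    simp only at h1
    rcases le_total i j with hij | hij
    · rw [h.symm]
      exact (hcongr (by omega) (by omega)).1 h1
    · exact (hcongr (by omega) (by omega)).1 h1
  · intro hm
    have hj := hlt j i ((h.symm i j).1 hm)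
    refine ⟨hj, (hT ⟨j, hj⟩ ⟨j, hj⟩ i).2 ⟨hlt i j hm, ?_⟩⟩
    simp only
    rcases le_total i j with hij | hij
    · rw [h.symm] at hm
      exact (hcongr (by omega) (by omega)).1 hm
    · exact (hcongr (by omega) (by omega)).1 hm

theorem rowLen_diag (T : TSPP m) : T.diag.rowLen m = 0 := by
  rw [rowLen_eq_iff]
  intro j
  simp only [Nat.not_lt_zero, iff_false, mem_diag]
  rintro ⟨h, h'⟩
  have := (T.1 ⟨j, h⟩ ⟨j, h⟩).2
  omega

/-- Totally symmetric plane partitions with self-conjugate diagonal correspond to sets of hooks. -/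
theorem bijOn_legs_diag (m : ℕ) : Set.BijOn (fun T : TSPP m => T.diag.legs)
    {T | T.diag.IsAsymmetric 0} (Finset.range m).powerset := by
  refine ⟨fun T hT => ?_, fun T hT T' hT' hTT' => ?_, fun s hs => ?_⟩
  · exact Finset.mem_coe.2 (Finset.mem_powerset.2 (legs_subset_range_iff.2 T.rowLen_diag))
  · have hd : T.diag = T'.diag := IsAsymmetric.eq_of_legs_eq hT hT' hTT'
    refine Subtype.ext (funext fun i => funext fun j => Fin.ext (eq_of_forall_lt_iff fun l => ?_))
    by_cases hl : l < m
    · rw [T.lt_iff_of_isAsymmetric hT i j ⟨l, hl⟩, T'.lt_iff_of_isAsymmetric hT' i j ⟨l, hl⟩, hd]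
    · have h1 := (T.1 i j).2
      have h2 := (T'.1 i j).2
      omega
  · obtain ⟨μ, hμ, rfl⟩ := exists_isAsymmetric_legs_eq 0 s fun c _ => Nat.cast_nonneg c
    obtain ⟨T, rfl⟩ := exists_diag_eq hμ
      (legs_subset_range_iff.1 (Finset.mem_powerset.1 (Finset.mem_coe.1 hs)))
    exact ⟨T, hμ, rfl⟩

theorem weight_of_isAsymmetric {R : Type*} [CommRing R] (T : TSPP m) (h : T.diag.IsAsymmetric 0)
    (u : R) : T.weight 1 u 1 0 = u ^ ∑ c ∈ T.diag.legs, (c + 1) := by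
  rw [weight, h.sum_arm_add_one, Finset.sum_eq_zero (s := Finset.range T.diag.durfee)
    (f := fun i => T.diag.leg i - T.diag.arm i)]
  · simp
  · intro i hi
    rw [h.arm_eq_leg (Finset.mem_range.1 hi), Nat.sub_self]

/-- Since `arm ≤ leg` on the diagonal of `T`, the exponent of `w` vanishes only if all arms equal
their legs. -/
theorem weight_of_not_isAsymmetric {R : Type*} [CommRing R] (T : TSPP m)
    (h : ¬ T.diag.IsAsymmetric 0) (u : R) : T.weight 1 u 1 0 = 0 := by
  rw [weight, zero_pow, mul_zero]
  intro hsum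
  apply h
  intro i hi
  have h1 := Finset.sum_eq_zero_iff.1 hsum i (Finset.mem_range.2 hi)
  have h2 := T.arm_le_leg i ((T.diag.diag_mem_iff i).2 hi)
  omega

end TSPP

/-! ### The generating function at `w = 0` -/

open YoungDiagram in
theorem tsppGenFun_eq_sum {R : Type*} [CommRing R] (n : ℕ) (k : ℤ) (hk : -1 ≤ k) (N : ℕ) (u : R) :
    tsppGenFun n k hk N 1 u 1 0 = ∑ s ∈ (Finset.range (n - 1)).powerset,
      MvPolynomial.C (u ^ ∑ c ∈ s, (c + 1)) * schurPoly R N (asymmetricOfLegs k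
        ((s.filter fun c : ℕ => 0 ≤ c + k).image fun c : ℕ => (c + k).toNat)) := by
  classical
  have hbij := TSPP.bijOn_legs_diag (n - 1)
  rw [tsppGenFun, ← Finset.sum_filter_of_ne (p := fun T : TSPP (n - 1) => T.diag.IsAsymmetric 0)]
  · refine Finset.sum_nbij (fun T => T.diag.legs) (fun T hT => hbij.mapsTo ?_) ?_ ?_ fun T hT => ?_
    · exact (Finset.mem_filter.1 hT).2
    · simpa using hbij.injOn
    · simpa using hbij.surjOn
    · have h := (Finset.mem_filter.1 hT).2
      have h' : (T.piPart k hk).IsAsymmetric k := h.frobeniusShift hk T.arm_le_leg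
      rw [T.weight_of_isAsymmetric h, ← legs_frobeniusShift hk T.arm_le_leg]
      exact congrArg _ (congrArg _ h'.asymmetricOfLegs_legs.symm)
  · intro T _ hT
    by_contra h
    rw [T.weight_of_not_isAsymmetric h, map_zero, zero_mul] at hT
    exact hT rfl

theorem sum_powerset_range_image_add_one {A : Type*} [AddCommMonoid A] (m : ℕ) (F : Finset ℕ → A) :
    ∑ s ∈ (Finset.range m).powerset, F (s.image (· + 1)) =
      ∑ s ∈ (Finset.Ico 1 (m + 1)).powerset, F s := by
  have : Finset.Ico 1 (m + 1) = (Finset.range m).image (· + 1) := by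
    rw [Finset.range_eq_Ico, Finset.image_add_right_Ico, zero_add]
  rw [this, Finset.powerset_image,
    Finset.sum_image (Finset.image_injective (add_left_injective 1)).injOn]

open YoungDiagram in
theorem tsppGenFun_one (n : ℕ) (hn : 1 ≤ n) :
    tsppGenFun n 1 (by norm_num) n (1 : ℚ) 1 1 0 =
      ∑ s ∈ (Finset.Ico 1 n).powerset, schurPoly ℚ n (asymmetricOfLegs 1 s) := by
  obtain ⟨m, rfl⟩ := Nat.exists_eq_add_of_le' hn
  rw [tsppGenFun_eq_sum, Nat.add_sub_cancel, ← sum_powerset_range_image_add_one]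
  refine Finset.sum_congr rfl fun s _ => ?_
  rw [one_pow, map_one, one_mul, Finset.filter_true_of_mem fun c _ => by omega]
  rfl

open YoungDiagram in
theorem tsppGenFun_zero (n : ℕ) :
    tsppGenFun (n + 1) 0 (by norm_num) n (1 : ℚ) (-1) 1 0 =
      ∑ s ∈ (Finset.range n).powerset,
        ((∏ c ∈ s, (-1) ^ (c + 1) : ℤ) : MvPolynomial (Fin n) ℚ) *
          schurPoly ℚ n (asymmetricOfLegs 0 s) := by
  rw [tsppGenFun_eq_sum, Nat.add_sub_cancel]
  refine Finset.sum_congr rfl fun s _ => ?_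
  rw [Finset.filter_true_of_mem fun c _ => by omega, Finset.prod_pow_eq_pow_sum]
  simp

open YoungDiagram in
theorem tsppGenFun_neg_one (n : ℕ) :
    tsppGenFun (n + 2) (-1) (by norm_num) n (1 : ℚ) 1 1 0 =
      (2 : ℚ) • ∑ s ∈ (Finset.range n).powerset, schurPoly ℚ n (asymmetricOfLegs (-1) s) := by
  have hrange : Finset.range (n + 1) = insert 0 (Finset.Ico 1 (n + 1)) := by
    rw [Finset.range_eq_Ico, ← Finset.insert_Ico_add_one_left_eq_Ico (Nat.succ_pos n), zero_add]
  have key : ∀ s : Finset ℕ, ((s.image (· + 1)).filter fun c : ℕ => 0 ≤ (c : ℤ) + -1).image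
      (fun c : ℕ => ((c : ℤ) + -1).toNat) = s := by
    intro s
    rw [Finset.filter_true_of_mem, Finset.image_image]
    · refine (Finset.image_congr fun c _ => ?_).trans Finset.image_id
      simp
    · intro c hc
      obtain ⟨a, _, rfl⟩ := Finset.mem_image.1 hc
      omega
  rw [tsppGenFun_eq_sum, show n + 2 - 1 = n + 1 by omega, hrange,
    -- Leg sets are split according to whether they contain `0`. That leg is dropped by the shift,
    -- so both halves give the same sum.
    Finset.sum_powerset_insert (by simp), ← sum_powerset_range_image_add_one,
    ← sum_powerset_range_image_add_one, two_smul]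
  congr 1
  · exact Finset.sum_congr rfl fun s _ => by rw [key, one_pow, map_one, one_mul]
  · refine Finset.sum_congr rfl fun s _ => ?_
    rw [Finset.filter_insert, if_neg (by norm_num), key, one_pow, map_one, one_mul]

open YoungDiagram in
theorem finsum_isAsymmetric_zero (n : ℕ) :
    ∑ᶠ μ ∈ {μ : YoungDiagram | μ.IsAsymmetric 0},
        (-1) ^ ((μ.card + μ.durfee) / 2) * schurPoly ℚ n μ =
      ∑ s ∈ (Finset.range n).powerset,
        ((∏ c ∈ s, (-1) ^ (c + 1) : ℤ) : MvPolynomial (Fin n) ℚ) *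
          schurPoly ℚ n (asymmetricOfLegs 0 s) := by
  rw [finsum_isAsymmetric 0 n _ fun μ h => by rw [schurPoly_eq_zero h, mul_zero],
    Int.toNat_zero, ← Finset.range_eq_Ico]
  refine Finset.sum_congr rfl fun s _ => ?_
  have hs : ∀ c ∈ s, (0 : ℤ) ≤ (c : ℕ) := fun c _ => Nat.cast_nonneg c
  rw [(isAsymmetric_asymmetricOfLegs hs).card_add_durfee_div_two, legs_asymmetricOfLegs hs,
    Finset.prod_pow_eq_pow_sum]
  simp
theorem mainTheorem3 (n : ℕ) (hn : 1 ≤ n) :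
    -- in each case only finitely many Schur polynomials in the sum are nonzero
    ({μ : YoungDiagram | μ.IsAsymmetric 1 ∧ schurPoly ℚ n μ ≠ 0}.Finite ∧
      tsppGenFun n 1 (by norm_num) n (1 : ℚ) 1 1 0 =
        ∑ᶠ μ ∈ {μ : YoungDiagram | μ.IsAsymmetric 1}, schurPoly ℚ n μ ∧
      ∑ᶠ μ ∈ {μ : YoungDiagram | μ.IsAsymmetric 1}, schurPoly ℚ n μ =
        ∏ i : Fin n, ∏ j ∈ Finset.Ioi i, (1 + MvPolynomial.X i * MvPolynomial.X j)) ∧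
    ({μ : YoungDiagram | μ.IsAsymmetric 0 ∧ schurPoly ℚ n μ ≠ 0}.Finite ∧
      tsppGenFun (n + 1) 0 (by norm_num) n (1 : ℚ) (-1) 1 0 =
        ∑ᶠ μ ∈ {μ : YoungDiagram | μ.IsAsymmetric 0},
          (-1) ^ ((μ.card + μ.durfee) / 2) * schurPoly ℚ n μ ∧
      ∑ᶠ μ ∈ {μ : YoungDiagram | μ.IsAsymmetric 0},
          (-1) ^ ((μ.card + μ.durfee) / 2) * schurPoly ℚ n μ =
        (∏ i : Fin n, (1 - MvPolynomial.X i)) *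
          ∏ i : Fin n, ∏ j ∈ Finset.Ioi i, (1 - MvPolynomial.X i * MvPolynomial.X j)) ∧
    ({μ : YoungDiagram | μ.IsAsymmetric (-1) ∧ schurPoly ℚ n μ ≠ 0}.Finite ∧
      (1 / 2 : ℚ) • tsppGenFun (n + 2) (-1) (by norm_num) n (1 : ℚ) 1 1 0 =
        ∑ᶠ μ ∈ {μ : YoungDiagram | μ.IsAsymmetric (-1)}, schurPoly ℚ n μ ∧
      ∑ᶠ μ ∈ {μ : YoungDiagram | μ.IsAsymmetric (-1)}, schurPoly ℚ n μ =
        (∏ i : Fin n, (1 + MvPolynomial.X i ^ 2)) *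
          ∏ i : Fin n, ∏ j ∈ Finset.Ioi i, (1 + MvPolynomial.X i * MvPolynomial.X j)) := by
  have h1 : ∑ᶠ μ ∈ {μ : YoungDiagram | μ.IsAsymmetric 1}, schurPoly ℚ n μ =
      ∑ s ∈ (Finset.Ico 1 n).powerset, schurPoly ℚ n (YoungDiagram.asymmetricOfLegs 1 s) :=
    YoungDiagram.finsum_isAsymmetric 1 n _ fun _ h => YoungDiagram.schurPoly_eq_zero h
  have h2 : ∑ᶠ μ ∈ {μ : YoungDiagram | μ.IsAsymmetric (-1)}, schurPoly ℚ n μ =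
      ∑ s ∈ (Finset.range n).powerset, schurPoly ℚ n (YoungDiagram.asymmetricOfLegs (-1) s) := by
    rw [Finset.range_eq_Ico]
    exact YoungDiagram.finsum_isAsymmetric (-1) n _ fun _ h => YoungDiagram.schurPoly_eq_zero h
  refine ⟨⟨YoungDiagram.finite_isAsymmetric_schurPoly_ne_zero ℚ 1 n, ?_, ?_⟩,
    ⟨YoungDiagram.finite_isAsymmetric_schurPoly_ne_zero ℚ 0 n, ?_, ?_⟩,
    ⟨YoungDiagram.finite_isAsymmetric_schurPoly_ne_zero ℚ (-1) n, ?_, ?_⟩⟩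
  · rw [h1, tsppGenFun_one n hn]
  · rw [h1, YoungDiagram.sum_schurPoly_one]
  · rw [finsum_isAsymmetric_zero, tsppGenFun_zero]
  · rw [finsum_isAsymmetric_zero, YoungDiagram.sum_schurPoly_zero]
  · rw [h2, tsppGenFun_neg_one, smul_smul]
    norm_num
  · rw [h2, YoungDiagram.sum_schurPoly_neg_one]
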